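/- Let $(R,\mathfrak m)$ be a commutative noetherian local ring of Krull dimension $d$. For an $R$-module $M$ put $\operatorname{Soc} M=(0:_M\mathfrak m)$, and let $H^i_{\mathfrak m}(M)$ denote its local cohomology modules. For a nonzero finitely generated $R$-module $M$ of dimension $t$ put $\mathfrak a_i(M)=\operatorname{ann}_R H^i_{\mathfrak m}(M)$ and $\mathfrak a(M)=\mathfrak a_0(M)\cdots\mathfrak a_{t-1}(M)$. A sequence $x_1,\dots,x_t\in\mathfrak m$ is a system of parameters of $M$ if $M/(x_1,\dots,x_t)M$ has finite length. For an integer $s\ge 1$ it is called $p_s$-standard if in addition $x_t\in\mathfrak a(M)$ and $x_i\in\mathfrak a(M/(x_{i+1}^s,\dots,x_t^s)M)$ for $i=1,\dots,t-1$ (for $t=0$ there is no such condition). **Proposition.** Let $s\ge 2$ and let $x_1,\dots,x_d$ be a $p_s$-standard system of parameters of $R$. Let $\varinjlim_j R/(x_1^j,\dots,x_d^j)$ be the direct limit of the system whose transition maps $R/(x_1^i,\dots,x_d^i)\to R/(x_1^j,\dots,x_d^j)$, $i\le j$, are multiplication by $(x_1\cdots x_d)^{j-i}$. Then there is an isomorphism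 of $R$-modules $\varinjlim_j R/(x_1^j,\dots,x_d^j)\cong H^d_{\mathfrak m}(R)$, and for every such isomorphism the composite $$R/(x_1^s,\dots,x_d^s)\longrightarrow \varinjlim_j R/(x_1^j,\dots,x_d^j)\;\cong\; H^d_{\mathfrak m}(R)$$ of the canonical map and the isomorphism induces a split surjection of $R$-modules $$\operatorname{Soc} R/(x_1^s,\dots,x_d^s)\longrightarrow \operatorname{Soc} H^d_{\mathfrak m}(R).$$ Moreover, for every $i\ge s$ the map $\operatorname{Soc} R/(x_1^i,\dots,x_d^i)\to\operatorname{Soc} H^d_{\mathfrak m}(R)$ induced in the same way is surjective. -/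

import Mathlib

open IsLocalRing

universe u

noncomputable section

namespace PsStandard

section Socle

variable (R : Type u) [CommRing R] [IsLocalRing R]

/-- The socle `(0 :_M 𝔪) = {y ∈ M | 𝔪 y = 0}` of a module over a local ring. -/
def socle (M : Type*) [AddCommGroup M] [Module R M] : Submodule R M :=
  Submodule.torsionBySet R M (maximalIdeal R : Set R)

variable {R}

/-- The map induced on socles by a linear map (its restriction). -/
def socleMap {M N : Type*} [AddCommGroup M] [Module R M] [AddCommGroup N] [Module R N]
    (f : M →ₗ[R] N) : socle R M →ₗ[R] socle R N :=
  f.restrict fun y hy => by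
    rw [socle, Submodule.mem_torsionBySet_iff] at hy ⊢
    intro a
    rw [← map_smul, hy a, map_zero]

end Socle

section LocalCohomology

variable (R : Type u) [CommRing R] [IsLocalRing R] (M : Type u) [AddCommGroup M] [Module R M]

/-- The local cohomology module `H^i_𝔪(M)`. -/
abbrev H (i : ℕ) : ModuleCat.{u} R :=
  (localCohomology (maximalIdeal R) i).obj (ModuleCat.of R M)

/-- The Krull dimension of `M` as a natural number. It is only used for nonzero finitely generated
modules over a noetherian local ring, whose dimension is a natural number. -/
def dim : ℕ := ENat.toNat ((Module.supportDim R M).unbotD 0)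

/-- `𝔞(M) = 𝔞_0(M) ⋯ 𝔞_{t-1}(M)`, where `t = dim M` and `𝔞_i(M)` is the annihilator of
`H^i_𝔪(M)`. -/
def 𝔞 : Ideal R := ∏ i ∈ Finset.range (dim R M), Module.annihilator R (H R M i)

variable {R}

/-- `x_1, …, x_t` (here indexed by `0, …, t - 1`) is a system of parameters of `M`: `dim M = t`, the
`x_i` lie in the maximal ideal, and `M/(x_1, …, x_t)M` has finite length. -/
structure IsSystemOfParameters {t : ℕ} (x : Fin t → R) : Prop where
  dim_eq : Module.supportDim R M = t
  mem_maximalIdeal : ∀ i, x i ∈ maximalIdeal R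
  finite_length :
    IsFiniteLength R (M ⧸ (Ideal.span (Set.range x) • (⊤ : Submodule R M)))

/-- A `p_s`-standard system of parameters of `M`: every `x_i` lies in
`𝔞(M/(x_{i+1}^s, …, x_t^s)M)`. For the last index the ideal `(x_{i+1}^s, …, x_t^s)` is zero, and
the condition says that `x_t` lies in `𝔞(M)`. -/
structure IsPsStandard (s : ℕ) {t : ℕ} (x : Fin t → R) : Prop
    extends IsSystemOfParameters M x where
  mem_𝔞 : ∀ i : Fin t,
    x i ∈ 𝔞 R (M ⧸ (Ideal.span ((fun j => x j ^ s) '' Set.Ioi i) • (⊤ : Submodule R M)))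

end LocalCohomology

section DirectSystem

variable {R : Type u} [CommRing R] {d : ℕ} (x : Fin d → R)

/-- The ideal `(x_1^j, …, x_d^j)`. -/
def powIdeal (j : ℕ) : Ideal R := Ideal.span (Set.range fun k => x k ^ j)

theorem powIdeal_le_comap {i j : ℕ} (h : i ≤ j) :
    powIdeal x i ≤
      Submodule.comap (LinearMap.mulLeft R ((∏ k, x k) ^ (j - i))) (powIdeal x j) := by
  rw [powIdeal, Ideal.span_le]
  rintro _ ⟨k, rfl⟩
  obtain ⟨c, hc⟩ := pow_dvd_pow_of_dvd (Finset.dvd_prod_of_mem x (Finset.mem_univ k)) (j - i)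
  change (∏ k, x k) ^ (j - i) * x k ^ i ∈ powIdeal x j
  have : (∏ k, x k) ^ (j - i) * x k ^ i = c * x k ^ j := by
    rw [hc, mul_right_comm, ← pow_add, Nat.sub_add_cancel h, mul_comm]
  rw [this]
  exact Ideal.mul_mem_left _ _ (Ideal.subset_span ⟨k, rfl⟩)

/-- The map `R/(x_1^i, …, x_d^i) → R/(x_1^j, …, x_d^j)`, `i ≤ j`, given by multiplication by
`(x_1 ⋯ x_d)^(j - i)`. -/
def transition (i j : ℕ) (h : i ≤ j) : (R ⧸ powIdeal x i) →ₗ[R] (R ⧸ powIdeal x j) :=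
  Submodule.mapQ _ _ (LinearMap.mulLeft R ((∏ k, x k) ^ (j - i))) (powIdeal_le_comap x h)

theorem transition_mk (i j : ℕ) (h : i ≤ j) (r : R) :
    transition x i j h (Ideal.Quotient.mk _ r) =
      Ideal.Quotient.mk _ ((∏ k, x k) ^ (j - i) * r) := rfl

/-- The transition maps form a directed system. -/
instance directedSystem :
    DirectedSystem (fun j => R ⧸ powIdeal x j) (fun i j h => transition x i j h) where
  map_self i r := by
    obtain ⟨r, rfl⟩ := Ideal.Quotient.mk_surjective r
    simp [transition_mk]
  map_map k j i hij hjk r := by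
    obtain ⟨r, rfl⟩ := Ideal.Quotient.mk_surjective r
    simp only [transition_mk]
    rw [← mul_assoc, ← pow_add, Nat.sub_add_sub_cancel hjk hij]

/-- The direct limit `lim_j R/(x_1^j, …, x_d^j)`. The index set is `ℕ`; the extra term `j = 0` in
front does not change the limit. -/
abbrev limit : Type u := Module.DirectLimit (fun j => R ⧸ powIdeal x j) (transition x)

/-- The canonical map `R/(x_1^i, …, x_d^i) → lim_j R/(x_1^j, …, x_d^j)`. -/
def toLimit (i : ℕ) : (R ⧸ powIdeal x i) →ₗ[R] limit x :=
  Module.DirectLimit.of R ℕ (fun j => R ⧸ powIdeal x j) (transition x) i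

end DirectSystem

end PsStandard

end

/-!
The proof reduces local cohomology to explicit direct limits and then lifts the socle of `H^d_𝔪(R)`
through one parameter at a time.

*Local cohomology and direct limits.* The colimit of the modules `Ext^i(R/𝔪^e, M)` is the `i`-th
cohomology of `Γ_𝔪(E)`, where `E` is an injective resolution of `M`
(`nonempty_cohomology_equiv_localCohomology`; this uses that `Ext` can be computed by projective
and by injective resolutions). Let `S` be a finite set of elements and `x` one more element. Over
a noetherian ring, `Γ_S(E^n) → Γ_S(E^n)_x` is surjective, by the Artin-Rees lemma
(`exists_pow_smul_sub_eq_zero`). The long exact sequence of `0 → Γ_x A → A → A_x → 0` for the complex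
`A = Γ_S(E)` therefore gives exact sequences
`0 → coker (H^n(A) → H^n(A)_x) → H^{n+1}(Γ_x A) → Γ_x(H^{n+1}(A)) → 0`.
They are used in the form of `exists_cocycle_insert`, `cocycles_le_coboundaries_insert` and
`exists_isTelescope_insert`. Adding the elements `x_1, …, x_k` one after the other, one finds that
the cohomology in degree `k` is the limit of the modules `M/(x_1^j, …, x_k^j)M`, with multiplication
by `x_1 ⋯ x_k` as transition maps, and that it vanishes in higher degrees
(`exists_isTelescope_cohomology`). The predicate `IsTelescope` expresses such a limit in terms of
elements. This proves the first claim.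

*The socle.* Fix `i`, let `M = R/(x_{i+2}^s, …, x_d^s)`, let `L` be the limit of the modules
`M/(x_1^j, …, x_i^j)M` and write `x = x_{i+1}`. The condition on `x` says that it annihilates
`H^i_𝔪(M)`. This module maps onto the `x`-power torsion of `L`, which is thus annihilated by `x`
(`IsPsStandard.exists_isTelescope_pair`). Now let `T` be the limit of the modules `L/x^j L`. An
element of `T` that is annihilated by `x` is the image of some `l ∈ L/xL`, and because `s ≥ 2` the
element `x^(s-1) l` of `L/x^s L` depends only on the given element of `T`. This is a linear section
of `L/x^s L → T` on `(0 :_T x)`, which contains the socle (`IsTelescope.exists_section`). For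
`i = d - 1` the module `T` is `H^d_𝔪(R)`, and `L/x^s L` is the module `T` that belongs to the
preceding index; for `i = 0` it is `R/(x_1^s, …, x_d^s)`. The composite of these sections splits the
map of socles (`IsPsStandard.exists_socle_section`).
-/

open IsLocalRing

namespace PsStandard

/-! ### Direct limits of quotients of a module -/

/-- A linear relation that is total and single-valued is the graph of a linear map. -/
theorem exists_linearMap_of_rel {R P Q : Type*} [CommRing R] [AddCommGroup P] [Module R P]
    [AddCommGroup Q] [Module R Q] (rel : P → Q → Prop) (total : ∀ p, ∃ q, rel p q)
    (add : ∀ p q p' q', rel p q → rel p' q' → rel (p + p') (q + q'))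
    (smul : ∀ (r : R) p q, rel p q → rel (r • p) (r • q))
    (zero : ∀ q, rel 0 q → q = 0) :
    ∃ f : P →ₗ[R] Q, ∀ p q, rel p q → f p = q := by
  have uniq : ∀ p q q', rel p q → rel p q' → q = q' := by
    intro p q q' h h'
    have := add _ _ _ _ h (smul (-1) _ _ h')
    rw [neg_one_smul, neg_one_smul, add_neg_cancel] at this
    exact sub_eq_zero.1 (by rw [sub_eq_add_neg]; exact zero _ this)
  choose f hf using total
  exact ⟨{ toFun := f
           map_add' := fun p p' => uniq _ _ _ (hf _) (add _ _ _ _ (hf p) (hf p'))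
           map_smul' := fun r p => uniq _ _ _ (hf _) (smul r _ _ (hf p)) },
    fun p q h => uniq _ _ _ (hf p) h⟩

section Telescope

variable {R M T T' : Type*} [CommRing R] [AddCommGroup M] [Module R M] [AddCommGroup T]
  [Module R T] [AddCommGroup T'] [Module R T']

/-- The maps `φ j : M → T` exhibit `T` as the direct limit of
`M/c 0 → M/c 1 → M/c 2 → ⋯`, all transition maps being multiplication by `y`. -/
structure IsTelescope (y : R) (c : ℕ → Submodule R M) (φ : ℕ → M →ₗ[R] T) : Prop where
  map_smul : ∀ j m, φ (j + 1) (y • m) = φ j m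
  surjective : ∀ t, ∃ j m, φ j m = t
  eq_zero_iff : ∀ j m, φ j m = 0 ↔ ∃ p, y ^ p • m ∈ c (j + p)

namespace IsTelescope

variable {y : R} {c : ℕ → Submodule R M} {φ : ℕ → M →ₗ[R] T}

theorem map_pow_smul (h : IsTelescope y c φ) (j p : ℕ) (m : M) :
    φ (j + p) (y ^ p • m) = φ j m := by
  induction p with
  | zero => simp
  | succ p ih => rw [← add_assoc, pow_succ', mul_smul, h.map_smul, ih]

theorem map_pow_sub_smul (h : IsTelescope y c φ) {i j : ℕ} (hij : i ≤ j) (m : M) :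
    φ j (y ^ (j - i) • m) = φ i m := by
  obtain ⟨p, rfl⟩ := Nat.exists_eq_add_of_le hij
  rw [Nat.add_sub_cancel_left, h.map_pow_smul]

theorem map_eq_zero_of_mem (h : IsTelescope y c φ) {j : ℕ} {m : M} (hm : m ∈ c j) :
    φ j m = 0 :=
  (h.eq_zero_iff j m).2 ⟨0, by simpa using hm⟩

theorem exists_ge (h : IsTelescope y c φ) (n : ℕ) (t : T) : ∃ j, n ≤ j ∧ ∃ m, φ j m = t := by
  obtain ⟨j, m, rfl⟩ := h.surjective t
  exact ⟨max n j, le_max_left _ _, _, h.map_pow_sub_smul (le_max_right n j) m⟩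

theorem congr (h : IsTelescope y c φ) {y' : R} {c' : ℕ → Submodule R M} (hy : y = y')
    (hc : ∀ j, c j = c' j) : IsTelescope y' c' φ := by
  obtain rfl : c = c' := funext hc
  exact hy ▸ h

/-- Two telescopes of the same system are isomorphic, compatibly with the structure maps. -/
theorem exists_linearEquiv {φ' : ℕ → M →ₗ[R] T'} (h : IsTelescope y c φ)
    (h' : IsTelescope y c φ') : ∃ e : T ≃ₗ[R] T', ∀ j m, e (φ j m) = φ' j m := by
  obtain ⟨f, hf⟩ := exists_linearMap_of_rel (R := R)
    (fun t t' => ∃ j m, φ j m = t ∧ φ' j m = t')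
    (fun t => by
      obtain ⟨j, m, rfl⟩ := h.surjective t
      exact ⟨_, j, m, rfl, rfl⟩)
    (by
      rintro _ _ _ _ ⟨j, m, rfl, rfl⟩ ⟨i, n, rfl, rfl⟩
      refine ⟨max j i, y ^ (max j i - j) • m + y ^ (max j i - i) • n, ?_, ?_⟩
      · rw [map_add, h.map_pow_sub_smul (le_max_left _ _), h.map_pow_sub_smul (le_max_right _ _)]
      · rw [map_add, h'.map_pow_sub_smul (le_max_left _ _),
          h'.map_pow_sub_smul (le_max_right _ _)])
    (by
      rintro r _ _ ⟨j, m, rfl, rfl⟩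
      exact ⟨j, r • m, _root_.map_smul _ _ _, _root_.map_smul _ _ _⟩)
    (by
      rintro _ ⟨j, m, hm, rfl⟩
      rwa [h'.eq_zero_iff, ← h.eq_zero_iff])
  have hf' : ∀ j m, f (φ j m) = φ' j m := fun j m => hf _ _ ⟨j, m, rfl, rfl⟩
  refine ⟨LinearEquiv.ofBijective f ⟨?_, ?_⟩, hf'⟩
  · rw [← LinearMap.ker_eq_bot, LinearMap.ker_eq_bot']
    intro t ht
    obtain ⟨j, m, rfl⟩ := h.surjective t
    rwa [hf', h'.eq_zero_iff, ← h.eq_zero_iff] at ht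
  · intro t
    obtain ⟨j, m, rfl⟩ := h'.surjective t
    exact ⟨_, hf' j m⟩

theorem comp_linearEquiv (h : IsTelescope y c φ) (e : T ≃ₗ[R] T') :
    IsTelescope y c (fun j => e.toLinearMap ∘ₗ φ j) where
  map_smul j m := congrArg e (h.map_smul j m)
  surjective t := by
    obtain ⟨j, m, hm⟩ := h.surjective (e.symm t)
    exact ⟨j, m, by simp [hm]⟩
  eq_zero_iff j m := by simpa using h.eq_zero_iff j m

theorem comp_surjective {N : Type*} [AddCommGroup N] [Module R N] (h : IsTelescope y c φ)
    {f : N →ₗ[R] M} (hf : Function.Surjective f) :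
    IsTelescope y (fun j => (c j).comap f) (fun j => φ j ∘ₗ f) where
  map_smul j m := by
    rw [LinearMap.comp_apply, _root_.map_smul, h.map_smul, LinearMap.comp_apply]
  surjective t := by
    obtain ⟨j, m, rfl⟩ := h.surjective t
    obtain ⟨n, rfl⟩ := hf m
    exact ⟨j, n, rfl⟩
  eq_zero_iff j m := by simp [h.eq_zero_iff]

open Pointwise in
/-- Passing to the quotient by `a` commutes with direct limits. -/
theorem mkQ_comp (h : IsTelescope y c φ) (a : R) :
    IsTelescope y (fun j => c j ⊔ a • ⊤)
      (fun j => (a • (⊤ : Submodule R T)).mkQ ∘ₗ φ j) where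
  map_smul j m := congrArg (Submodule.mkQ _) (h.map_smul j m)
  surjective t := by
    obtain ⟨t, rfl⟩ := Submodule.mkQ_surjective _ t
    obtain ⟨j, m, rfl⟩ := h.surjective t
    exact ⟨j, m, rfl⟩
  eq_zero_iff j m := by
    rw [LinearMap.comp_apply, Submodule.mkQ_apply, Submodule.Quotient.mk_eq_zero,
      Submodule.mem_smul_pointwise_iff_exists]
    constructor
    · rintro ⟨t, -, ht⟩
      obtain ⟨n, hn, m', rfl⟩ := h.exists_ge j t
      obtain ⟨k, rfl⟩ := Nat.exists_eq_add_of_le hn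
      rw [← _root_.map_smul, ← h.map_pow_smul j k m, eq_comm, ← sub_eq_zero, ← map_sub,
        h.eq_zero_iff] at ht
      obtain ⟨p, hp⟩ := ht
      refine ⟨k + p, ?_⟩
      have : y ^ (k + p) • m = y ^ p • (y ^ k • m - a • m') + a • (y ^ p • m') := by
        rw [smul_sub, smul_smul, smul_comm a, sub_add_cancel, add_comm k, pow_add]
      rw [this, ← add_assoc]
      exact Submodule.add_mem_sup hp
        ((Submodule.mem_smul_pointwise_iff_exists _ _ _).2 ⟨_, trivial, rfl⟩)
    · rintro ⟨p, hp⟩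
      obtain ⟨w, hw, _, hv, hm⟩ := Submodule.mem_sup.1 hp
      obtain ⟨v, -, rfl⟩ := (Submodule.mem_smul_pointwise_iff_exists _ _ _).1 hv
      refine ⟨φ (j + p) v, trivial, ?_⟩
      rw [← h.map_pow_smul j p m, ← hm, map_add, h.map_eq_zero_of_mem hw, zero_add,
        _root_.map_smul]

open Pointwise in
/-- A direct limit over two independent exponents is the limit over the diagonal. -/
theorem comp {x : R} {ψ : ℕ → T →ₗ[R] T'} (h : IsTelescope y c φ)
    (hψ : IsTelescope x (fun j => x ^ j • (⊤ : Submodule R T)) ψ)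
    (hc : ∀ j m, m ∈ c j → y • m ∈ c (j + 1)) :
    IsTelescope (x * y) (fun j => c j ⊔ x ^ j • (⊤ : Submodule R M)) (fun j => ψ j ∘ₗ φ j) where
  map_smul j m := by
    rw [LinearMap.comp_apply, mul_smul, _root_.map_smul, hψ.map_smul, h.map_smul]
    rfl
  surjective t := by
    obtain ⟨i, s, rfl⟩ := hψ.surjective t
    obtain ⟨j, hj, m, rfl⟩ := h.exists_ge i s
    refine ⟨j, x ^ (j - i) • m, ?_⟩
    rw [LinearMap.comp_apply, _root_.map_smul, hψ.map_pow_sub_smul hj]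
  eq_zero_iff j m := by
    have hc' : ∀ p j m, m ∈ c j → y ^ p • m ∈ c (j + p) := by
      intro p
      induction p with
      | zero => intro j m hm; simpa using hm
      | succ p ih => intro j m hm; rw [pow_succ', mul_smul]; exact hc _ _ (ih _ _ hm)
    rw [LinearMap.comp_apply, hψ.eq_zero_iff]
    constructor
    · rintro ⟨p, hp⟩
      obtain ⟨t, -, ht⟩ := (Submodule.mem_smul_pointwise_iff_exists _ _ _).1 hp
      obtain ⟨n, hn, m', rfl⟩ := h.exists_ge j t
      obtain ⟨k, rfl⟩ := Nat.exists_eq_add_of_le hn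
      rw [← _root_.map_smul, ← h.map_pow_smul j k m, ← _root_.map_smul, eq_comm, ← sub_eq_zero,
        ← map_sub, h.eq_zero_iff] at ht
      obtain ⟨q, hq⟩ := ht
      -- the exponents `p` of `x` and `k + q` of `y` are brought to the common value `p + (k + q)`
      refine ⟨p + (k + q), ?_⟩
      have : (x * y) ^ (p + (k + q)) • m =
          x ^ (k + q) • y ^ p • (y ^ q • (x ^ p • y ^ k • m - x ^ (j + p) • m')) +
            x ^ (j + (p + (k + q))) • (y ^ (p + q) • m') := by
        simp only [smul_sub, smul_smul]
        rw [show x ^ (k + q) * (y ^ p * (y ^ q * x ^ (j + p))) =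
          x ^ (j + (p + (k + q))) * y ^ (p + q) by ring, sub_add_cancel]
        congr 1
        ring
      rw [this]
      refine Submodule.add_mem_sup (Submodule.smul_mem _ _ ?_)
        ((Submodule.mem_smul_pointwise_iff_exists _ _ _).2 ⟨_, trivial, rfl⟩)
      have := hc' p _ _ hq
      rwa [show j + k + q + p = j + (p + (k + q)) by ring] at this
    · rintro ⟨p, hp⟩
      obtain ⟨w, hw, _, hv, hm⟩ := Submodule.mem_sup.1 hp
      obtain ⟨v, -, rfl⟩ := (Submodule.mem_smul_pointwise_iff_exists _ _ _).1 hv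
      refine ⟨p, (Submodule.mem_smul_pointwise_iff_exists _ _ _).2 ⟨φ (j + p) v, trivial, ?_⟩⟩
      rw [← h.map_pow_smul j p m, ← _root_.map_smul (φ (j + p)) (x ^ p), smul_smul, ← mul_pow,
        ← hm, map_add, h.map_eq_zero_of_mem hw, zero_add, _root_.map_smul]

open Pointwise in
/-- If `x` kills all `x`-power torsion of `T` and `T'` is the limit of the `T/x^j T`, then
`x^(s-1) : T/xT → T/x^s T` factors through the image of `T/xT` in `T'`. This image contains
`(0 :_{T'} x)`, and the factorization is a section of `T/x^s T → T'` over `(0 :_{T'} x)`. -/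
theorem exists_section {x : R} {ψ : ℕ → T →ₗ[R] T'}
    (hψ : IsTelescope x (fun j => x ^ j • (⊤ : Submodule R T)) ψ)
    (htor : ∀ (p : ℕ) (t : T), x ^ p • t = 0 → x • t = 0) {s : ℕ} (hs : 2 ≤ s) :
    ∃ τ : Submodule.torsionBy R T' x →ₗ[R] T ⧸ (x ^ s • (⊤ : Submodule R T)),
      ∀ z t, Submodule.Quotient.mk t = τ z → ψ s t = z := by
  obtain ⟨s, rfl⟩ : ∃ k, s = k + 2 := ⟨s - 2, by omega⟩
  have hsmul : ∀ (j : ℕ) (t : T), x ^ j • t ∈ x ^ j • (⊤ : Submodule R T) := fun j t =>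
    (Submodule.mem_smul_pointwise_iff_exists _ _ _).2 ⟨t, trivial, rfl⟩
  have hkill : ∀ (p : ℕ) (t : T), x ^ p • t = 0 → ∀ z, x ^ (z + 1) • t = 0 := by
    intro p t h z
    rw [pow_succ, mul_smul, htor p t h, smul_zero]
  have total : ∀ z : Submodule.torsionBy R T' x, ∃ t, ψ 1 t = z := by
    rintro ⟨z, hz⟩
    rw [Submodule.mem_torsionBy_iff] at hz
    obtain ⟨j, hj, l, rfl⟩ := hψ.exists_ge 1 z
    obtain ⟨j, rfl⟩ := Nat.exists_eq_add_of_le' hj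
    rw [← _root_.map_smul, hψ.eq_zero_iff] at hz
    obtain ⟨p, hp⟩ := hz
    obtain ⟨l', -, hl'⟩ := (Submodule.mem_smul_pointwise_iff_exists _ _ _).1 hp
    refine ⟨l', ?_⟩
    -- `l - x ^ j • l'` is `x`-power torsion, hence killed by `x`, hence zero in the limit
    have h0 : x ^ (p + 1) • (l - x ^ j • l') = 0 := by
      rw [smul_sub, smul_smul, ← pow_add, pow_succ, mul_smul, ← hl', sub_eq_zero]
      congr 2
      ring
    have h1 : ψ (j + 1) (l - x ^ j • l') = 0 := by
      rw [← hψ.map_smul, htor _ _ h0, map_zero]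
    rw [map_sub, sub_eq_zero] at h1
    change _ = ψ (j + 1) l
    rw [h1, add_comm j 1, hψ.map_pow_smul]
  obtain ⟨τ, hτ⟩ := exists_linearMap_of_rel (R := R)
    (fun (z : Submodule.torsionBy R T' x) (u : T ⧸ (x ^ (s + 2) • (⊤ : Submodule R T))) =>
      ∃ t, ψ 1 t = z ∧ Submodule.Quotient.mk (x ^ (s + 1) • t) = u)
    (fun z => by
      obtain ⟨t, ht⟩ := total z
      exact ⟨_, t, ht, rfl⟩)
    (by
      rintro z _ z' _ ⟨t, ht, rfl⟩ ⟨t', ht', rfl⟩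
      exact ⟨t + t', by simp [ht, ht'], by simp⟩)
    (by
      rintro r z _ ⟨t, ht, rfl⟩
      refine ⟨r • t, by simp [ht], ?_⟩
      rw [smul_comm]
      rfl)
    (by
      rintro _ ⟨t, ht, rfl⟩
      rw [Submodule.coe_zero, hψ.eq_zero_iff] at ht
      obtain ⟨p, hp⟩ := ht
      obtain ⟨l, -, hl⟩ := (Submodule.mem_smul_pointwise_iff_exists _ _ _).1 hp
      have h0 : x ^ p • (t - x • l) = 0 := by
        rw [smul_sub, smul_smul, ← pow_succ, ← hl, add_comm, sub_self]
      have h1 := hkill p _ h0 s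
      rw [smul_sub, smul_smul, ← pow_succ, sub_eq_zero] at h1
      rw [Submodule.Quotient.mk_eq_zero, h1]
      exact hsmul _ _)
  refine ⟨τ, fun z t ht => ?_⟩
  obtain ⟨t', ht'⟩ := total z
  rw [hτ z _ ⟨t', ht', rfl⟩, Submodule.Quotient.eq] at ht
  have := hψ.map_eq_zero_of_mem ht
  rw [map_sub, sub_eq_zero] at this
  rw [this, ← ht', ← hψ.map_pow_smul 1 (s + 1), add_comm 1]

end IsTelescope

end Telescope

/-! ### Torsion with respect to a set of elements -/

section PowTorsion

variable {R : Type u} [CommRing R] (S : Set R) (N : Type u) [AddCommGroup N] [Module R N]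

/-- The elements of `N` that are killed by a power of each element of `S`. For a finite set `S`
this is the `I`-torsion functor `Γ_I(N)`, where `I` is the ideal generated by `S`. -/
def powTorsion : Submodule R N where
  carrier := {a | ∀ r ∈ S, ∃ e : ℕ, r ^ e • a = 0}
  zero_mem' _ _ := ⟨0, smul_zero _⟩
  add_mem' {a b} ha hb r hr := by
    obtain ⟨e, he⟩ := ha r hr
    obtain ⟨f, hf⟩ := hb r hr
    refine ⟨e + f, ?_⟩
    rw [smul_add, pow_add, mul_comm, mul_smul, he, mul_comm, mul_smul, hf]
    simp
  smul_mem' c a ha r hr := by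
    obtain ⟨e, he⟩ := ha r hr
    exact ⟨e, by rw [smul_comm, he, smul_zero]⟩

variable {S N}

theorem mem_powTorsion {a : N} : a ∈ powTorsion S N ↔ ∀ r ∈ S, ∃ e : ℕ, r ^ e • a = 0 :=
  Iff.rfl

theorem mem_powTorsion_insert {x : R} {a : N} :
    a ∈ powTorsion (insert x S) N ↔ (∃ e : ℕ, x ^ e • a = 0) ∧ a ∈ powTorsion S N := by
  simp [mem_powTorsion]

theorem mem_powTorsion_iff_le_radical {a : N} :
    a ∈ powTorsion S N ↔ Ideal.span S ≤ (Ideal.torsionOf R N a).radical := by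
  rw [Ideal.span_le]
  rfl

theorem pow_smul_eq_zero_of_le {x : R} {a : N} {m n : ℕ} (hmn : m ≤ n) (h : x ^ m • a = 0) :
    x ^ n • a = 0 := by
  rw [← Nat.sub_add_cancel hmn, pow_add, mul_smul, h, smul_zero]

theorem map_mem_powTorsion {N' : Type u} [AddCommGroup N'] [Module R N'] (f : N →ₗ[R] N') {a : N}
    (ha : a ∈ powTorsion S N) : f a ∈ powTorsion S N' := fun r hr => by
  obtain ⟨e, he⟩ := ha r hr
  exact ⟨e, by rw [← map_smul, he, map_zero]⟩

/-- `powTorsion S N` depends only on the radical of the ideal generated by `S`. -/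
theorem powTorsion_eq_of_radical_eq {S' : Set R}
    (h : (Ideal.span S).radical = (Ideal.span S').radical) :
    powTorsion S N = powTorsion S' N := by
  ext a
  rw [mem_powTorsion_iff_le_radical, mem_powTorsion_iff_le_radical,
    ← Ideal.radical_le_radical_iff, h, Ideal.radical_le_radical_iff]

theorem exists_pow_smul_eq_zero [IsNoetherianRing R] {I : Ideal R} {a : N}
    (ha : a ∈ powTorsion (I : Set R) N) : ∃ e : ℕ, ∀ r ∈ I ^ e, r • a = 0 := by
  rw [mem_powTorsion_iff_le_radical, Ideal.span_eq] at ha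
  obtain ⟨e, he⟩ := Ideal.exists_pow_le_of_le_radical_of_fg ha (IsNoetherian.noetherian I)
  exact ⟨e, fun r hr => (Ideal.mem_torsionOf_iff a r).1 (he hr)⟩

/-- Over a noetherian ring, an injective module `N` has the property that `Γ_S(N) → Γ_S(N)_x` is
surjective for every `x`. -/
theorem exists_pow_smul_sub_eq_zero [IsNoetherianRing R] [Module.Injective R N] {a : N}
    (ha : a ∈ powTorsion S N) (x : R) (j : ℕ) :
    ∃ b ∈ powTorsion S N, ∃ l : ℕ, x ^ l • (x ^ j • b - a) = 0 := by
  set J := Ideal.span S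
  obtain ⟨e, he⟩ : ∃ e : ℕ, ∀ r ∈ J ^ e, r • a = 0 := by
    apply exists_pow_smul_eq_zero
    rw [mem_powTorsion_iff_le_radical] at ha ⊢
    rwa [Ideal.span_eq]
  -- the annihilators of the powers of `x` become stationary at `x ^ m`
  obtain ⟨m, hm⟩ : ∃ m : ℕ, ∀ r : R, r * x ^ (m + j) = 0 → r * x ^ m = 0 := by
    have hmono : Monotone fun m : ℕ => Ideal.torsionOf R R (x ^ m) := by
      intro m n hmn r hr
      rw [Ideal.mem_torsionOf_iff, smul_eq_mul] at hr ⊢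
      rw [← Nat.add_sub_cancel' hmn, pow_add, ← mul_assoc, hr, zero_mul]
    obtain ⟨m, hm⟩ := monotone_stabilizes_iff_noetherian.2 ‹IsNoetherianRing R› ⟨_, hmono⟩
    refine ⟨m, fun r hr => ?_⟩
    have := hm (m + j) (Nat.le_add_right _ _)
    have h2 : r ∈ Ideal.torsionOf R R (x ^ (m + j)) := by
      rwa [Ideal.mem_torsionOf_iff, smul_eq_mul]
    change Ideal.torsionOf R R (x ^ m) = Ideal.torsionOf R R (x ^ (m + j)) at this
    rw [← this, Ideal.mem_torsionOf_iff, smul_eq_mul] at h2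
    exact h2
  -- by Artin-Rees, `r * x ^ (m + j) ∈ J ^ (k + e)` implies `r * x ^ m ∈ J ^ e`
  obtain ⟨k, hk⟩ := Ideal.exists_pow_inf_eq_pow_smul J (Ideal.span {x ^ (m + j)} : Ideal R)
  have hkill : ∀ r : R, r * x ^ (m + j) ∈ J ^ (k + e) → (r * x ^ m) • a = 0 := by
    intro r hr
    have h1 : r * x ^ (m + j) ∈ J ^ (k + e) • (⊤ : Ideal R) ⊓ Ideal.span {x ^ (m + j)} :=
      ⟨by simpa using hr, Ideal.mem_span_singleton'.2 ⟨r, rfl⟩⟩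
    rw [hk (k + e) (Nat.le_add_right _ _), Nat.add_sub_cancel_left] at h1
    have h2 : r * x ^ (m + j) ∈ J ^ e * Ideal.span {x ^ (m + j)} :=
      Ideal.mul_mono_right inf_le_right h1
    obtain ⟨c, hc, hcr⟩ := Ideal.mem_mul_span_singleton.1 h2
    have h3 := hm (r - c) (by rw [sub_mul, hcr, sub_self])
    rw [sub_mul, sub_eq_zero] at h3
    rw [h3, mul_comm, mul_smul, he c hc, smul_zero]
  let f : R →ₗ[R] R ⧸ J ^ (k + e) := (J ^ (k + e)).mkQ ∘ₗ LinearMap.toSpanSingleton R R (x ^ (m + j))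
  let g : R →ₗ[R] N := LinearMap.toSpanSingleton R N (x ^ m • a)
  have hfg : LinearMap.ker f ≤ LinearMap.ker g := by
    intro r hr
    rw [LinearMap.mem_ker] at hr ⊢
    have : r * x ^ (m + j) ∈ J ^ (k + e) := by
      rw [← Ideal.Quotient.eq_zero_iff_mem]
      exact hr
    have := hkill r this
    rwa [mul_smul] at this
  obtain ⟨h, hh⟩ := Module.Injective.out ((LinearMap.ker f).liftQ f le_rfl)
    (LinearMap.ker_eq_bot.1 (Submodule.ker_liftQ_eq_bot _ _ _ le_rfl))
    ((LinearMap.ker f).liftQ g hfg)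
  have h1 : h (f 1) = g 1 := hh (Submodule.Quotient.mk 1)
  have hf1 : f 1 = x ^ (m + j) • (Submodule.Quotient.mk 1 : R ⧸ J ^ (k + e)) := by
    rw [← Submodule.Quotient.mk_smul, smul_eq_mul, mul_one]
    simp [f]
  refine ⟨h (Submodule.Quotient.mk 1), fun r hr => ⟨k + e, ?_⟩, m, ?_⟩
  · rw [← map_smul, ← Submodule.Quotient.mk_smul, (Submodule.Quotient.mk_eq_zero _).2, map_zero]
    simpa using Ideal.pow_mem_pow (Ideal.subset_span hr) (k + e)
  · rw [hf1, map_smul] at h1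
    rw [smul_sub, smul_smul, ← pow_add, h1]
    simp [g]

end PowTorsion

/-! ### Cohomology of the torsion of a complex -/

section Cohomology

variable {R : Type u} [CommRing R] {I : ℕ → Type u} [∀ n, AddCommGroup (I n)]
  [∀ n, Module R (I n)] (d : ∀ n, I n →ₗ[R] I (n + 1)) (S : Set R)

/-- The cocycles of the complex `powTorsion S I`. -/
def cocycles (n : ℕ) : Submodule R (I n) := powTorsion S (I n) ⊓ LinearMap.ker (d n)

/-- The coboundaries of the complex `powTorsion S I`; there are none in degree `0`. -/
def coboundaries : ∀ n, Submodule R (I n)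
  | 0 => ⊥
  | n + 1 => (powTorsion S (I n)).map (d n)

/-- The cohomology of the complex `powTorsion S I`. -/
abbrev Cohomology (n : ℕ) : Type u :=
  cocycles d S n ⧸ (coboundaries d S n).submoduleOf (cocycles d S n)

variable {d S}

theorem mem_cocycles {n : ℕ} {z : I n} :
    z ∈ cocycles d S n ↔ z ∈ powTorsion S (I n) ∧ d n z = 0 := by
  simp [cocycles]

theorem mem_coboundaries_zero {z : I 0} : z ∈ coboundaries d S 0 ↔ z = 0 := by
  simp [coboundaries]

theorem mem_coboundaries_succ {n : ℕ} {z : I (n + 1)} :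
    z ∈ coboundaries d S (n + 1) ↔ ∃ a ∈ powTorsion S (I n), d n a = z := by
  simp [coboundaries]

theorem cohomology_mk_eq_zero {n : ℕ} {z : cocycles d S n} :
    (Submodule.Quotient.mk z : Cohomology d S n) = 0 ↔ (z : I n) ∈ coboundaries d S n := by
  rw [Submodule.Quotient.mk_eq_zero]
  rfl

theorem cohomology_mk_eq {n : ℕ} {z w : cocycles d S n} :
    (Submodule.Quotient.mk z : Cohomology d S n) = Submodule.Quotient.mk w ↔
      (z - w : I n) ∈ coboundaries d S n := by
  rw [Submodule.Quotient.eq]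
  rfl

theorem coboundaries_insert_le (x : R) (n : ℕ) :
    coboundaries d (insert x S) n ≤ coboundaries d S n := by
  cases n with
  | zero => exact le_rfl
  | succ n => exact Submodule.map_mono fun a ha => (mem_powTorsion_insert.1 ha).2

theorem cocycles_insert_le (x : R) (n : ℕ) : cocycles d (insert x S) n ≤ cocycles d S n :=
  inf_le_inf_right _ fun _ ha => (mem_powTorsion_insert.1 ha).2

variable {x : R} (hd : ∀ n a, d (n + 1) (d n a) = 0)
  (hdiv : ∀ (n : ℕ) (a : I n), a ∈ powTorsion S (I n) → ∀ j : ℕ,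
    ∃ b ∈ powTorsion S (I n), ∃ l : ℕ, x ^ l • (x ^ j • b - a) = 0)

include hd hdiv

/-- The `x`-power torsion of the cohomology of `Γ_S(I)` comes from the cohomology of
`Γ_x(Γ_S(I))`. -/
theorem exists_cocycle_insert {n : ℕ} {z : I n} (hz : z ∈ cocycles d S n) {p : ℕ}
    (hp : x ^ p • z ∈ coboundaries d S n) :
    ∃ z' ∈ cocycles d (insert x S) n, z - z' ∈ coboundaries d S n := by
  obtain ⟨hzS, hdz⟩ := mem_cocycles.1 hz
  cases n with
  | zero =>
    rw [mem_coboundaries_zero] at hp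
    exact ⟨z, mem_cocycles.2 ⟨mem_powTorsion_insert.2 ⟨⟨p, hp⟩, hzS⟩, hdz⟩, by
      rw [sub_self]; exact zero_mem _⟩
  | succ n =>
    obtain ⟨a, ha, hda⟩ := mem_coboundaries_succ.1 hp
    obtain ⟨b, hb, l, hl⟩ := hdiv n a ha p
    -- `b` represents the fraction `a / x ^ p`, so that `z` and `d b` agree up to `x`-power torsion
    refine ⟨z - d n b, mem_cocycles.2 ⟨mem_powTorsion_insert.2 ⟨⟨l + p, ?_⟩,
      sub_mem hzS (map_mem_powTorsion _ hb)⟩, ?_⟩, ?_⟩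
    · rw [pow_add, mul_smul, smul_sub (x ^ p), ← hda, ← map_smul, ← map_sub, ← map_smul,
        ← neg_sub, smul_neg, hl, neg_zero, map_zero]
    · rw [map_sub, hdz, hd, sub_zero]
    · rw [sub_sub_cancel]
      exact mem_coboundaries_succ.2 ⟨b, hb, rfl⟩

/-- `H^{n+1}(Γ_x(Γ_S(I)))` is an extension of a submodule of `H^{n+1}(Γ_S(I))` by the cokernel of
`H^n(Γ_S(I)) → H^n(Γ_S(I))_x`; hence it vanishes if `H^{n+1}(Γ_S(I))` is zero and `H^n(Γ_S(I))` is
`x`-power torsion. -/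
theorem cocycles_le_coboundaries_insert {n : ℕ}
    (h : cocycles d S (n + 1) ≤ coboundaries d S (n + 1))
    (htor : ∀ z ∈ cocycles d S n, ∃ p : ℕ, x ^ p • z ∈ coboundaries d S n) :
    cocycles d (insert x S) (n + 1) ≤ coboundaries d (insert x S) (n + 1) := by
  intro z hz
  obtain ⟨b, hb, rfl⟩ := mem_coboundaries_succ.1 (h (cocycles_insert_le x _ hz))
  obtain ⟨j, hj⟩ := (mem_powTorsion_insert.1 (mem_cocycles.1 hz).1).1
  obtain ⟨p, hp⟩ := htor (x ^ j • b) (mem_cocycles.2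
    ⟨Submodule.smul_mem _ _ hb, by rw [map_smul, hj]⟩)
  rw [smul_smul, ← pow_add] at hp
  rw [mem_coboundaries_succ]
  cases n with
  | zero => exact ⟨b, mem_powTorsion_insert.2 ⟨⟨_, mem_coboundaries_zero.1 hp⟩, hb⟩, rfl⟩
  | succ n =>
    obtain ⟨a, ha, hda⟩ := mem_coboundaries_succ.1 hp
    obtain ⟨c, hc, l, hl⟩ := hdiv n a ha (p + j)
    refine ⟨b - d n c, mem_powTorsion_insert.2 ⟨⟨l + (p + j), ?_⟩,
      sub_mem hb (map_mem_powTorsion _ hc)⟩, by rw [map_sub, hd, sub_zero]⟩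
    rw [pow_add, mul_smul, smul_sub (x ^ (p + j)), ← hda, ← map_smul, ← map_sub, ← map_smul,
      ← neg_sub, smul_neg, hl, neg_zero, map_zero]

open Pointwise in
/-- If `H^{n+1}(Γ_S(I)) = 0`, then `H^{n+1}(Γ_x(Γ_S(I)))` is the cokernel of
`H^n(Γ_S(I)) → H^n(Γ_S(I))_x`. The class of the fraction `z / x ^ j` goes to the class of `d b`,
where `b` represents this fraction in `Γ_S(I^n)`. -/
theorem exists_isTelescope_insert {n : ℕ}
    (h : cocycles d S (n + 1) ≤ coboundaries d S (n + 1)) :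
    ∃ ψ : ℕ → Cohomology d S n →ₗ[R] Cohomology d (insert x S) (n + 1),
      IsTelescope x (fun j => x ^ j • (⊤ : Submodule R (Cohomology d S n))) ψ := by
  -- `rel j t t'` holds if `t'` is the image of the fraction `t / x ^ j`
  let rel : ℕ → Cohomology d S n → Cohomology d (insert x S) (n + 1) → Prop := fun j t t' =>
    ∃ (z : cocycles d S n) (b : I n) (z' : cocycles d (insert x S) (n + 1)),
      b ∈ powTorsion S (I n) ∧ (∃ l : ℕ, x ^ l • (x ^ j • b - z) = 0) ∧ (z' : I (n + 1)) = d n b ∧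
      Submodule.Quotient.mk z = t ∧ Submodule.Quotient.mk z' = t'
  have hmem : ∀ (j l : ℕ) (z : cocycles d S n) (b : I n), b ∈ powTorsion S (I n) →
      x ^ l • (x ^ j • b - (z : I n)) = 0 → d n b ∈ cocycles d (insert x S) (n + 1) := by
    intro j l z b hb hl
    refine mem_cocycles.2 ⟨mem_powTorsion_insert.2 ⟨⟨l + j, ?_⟩, map_mem_powTorsion _ hb⟩, hd _ _⟩
    have := congrArg (d n) hl
    rwa [map_smul, map_sub, (mem_cocycles.1 z.2).2, sub_zero, map_smul, map_zero, smul_smul,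
      ← pow_add] at this
  -- fractions `t / x ^ j` that are equal to an element of `H^n(Γ_S(I))` have image zero
  have key : ∀ j t, (∃ p : ℕ, x ^ p • t ∈ x ^ (j + p) • (⊤ : Submodule R (Cohomology d S n))) →
      ∀ t', rel j t t' → t' = 0 := by
    rintro j _ ⟨p, hp⟩ _ ⟨z, b, z', hb, ⟨l, hl⟩, hz', rfl, rfl⟩
    obtain ⟨w, -, hw⟩ := (Submodule.mem_smul_pointwise_iff_exists _ _ _).1 hp
    obtain ⟨w, rfl⟩ := Submodule.Quotient.mk_surjective _ w
    rw [← Submodule.Quotient.mk_smul, ← Submodule.Quotient.mk_smul, cohomology_mk_eq] at hw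
    rw [cohomology_mk_eq_zero, hz', mem_coboundaries_succ]
    obtain ⟨hwS, hdw⟩ := mem_cocycles.1 w.2
    cases n with
    | zero =>
      rw [mem_coboundaries_zero, sub_eq_zero] at hw
      refine ⟨b - w, mem_powTorsion_insert.2 ⟨⟨l + (j + p), ?_⟩, sub_mem hb hwS⟩, by
        rw [map_sub, hdw, sub_zero]⟩
      have hw' : x ^ (j + p) • (w : I 0) = x ^ p • (z : I 0) := hw
      have : x ^ (l + (j + p)) • (b - w : I 0) = x ^ p • (x ^ l • (x ^ j • b - (z : I 0))) := by
        rw [pow_add, mul_smul, smul_sub (x ^ (j + p)), hw', smul_comm (x ^ p), smul_sub (x ^ p),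
          smul_smul (x ^ p), ← pow_add, add_comm p]
      rw [this, hl, smul_zero]
    | succ n =>
      obtain ⟨a, ha, hda⟩ := mem_coboundaries_succ.1 hw
      obtain ⟨c, hc, k, hk⟩ := hdiv n a ha (j + p)
      have hda' : d n a = x ^ (j + p) • (w : I (n + 1)) - x ^ p • (z : I (n + 1)) := hda
      refine ⟨b - w + d n c, mem_powTorsion_insert.2 ⟨⟨l + k + (j + p), ?_⟩,
        add_mem (sub_mem hb hwS) (map_mem_powTorsion _ hc)⟩, by
          rw [map_add, hd, map_sub, hdw, sub_zero, add_zero]⟩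
      have h1 := congrArg (d n) hk
      rw [map_smul, map_sub, hda', map_smul, map_zero] at h1
      have : x ^ (l + k + (j + p)) • (b - w + d n c) =
          x ^ (k + p) • (x ^ l • (x ^ j • b - (z : I (n + 1)))) +
          x ^ l • (x ^ k • (x ^ (j + p) • d n c -
            (x ^ (j + p) • (w : I (n + 1)) - x ^ p • (z : I (n + 1))))) := by
        simp only [smul_sub, smul_add, smul_smul, ← pow_add]
        rw [show l + k + (j + p) = k + p + (l + j) by ring,
          show l + (k + (j + p)) = k + p + (l + j) by ring,
          show l + (k + p) = k + p + l by ring]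
        abel
      rw [this, hl, h1, smul_zero, smul_zero, add_zero]
  have total : ∀ j t, ∃ t', rel j t t' := by
    intro j t
    obtain ⟨z, rfl⟩ := Submodule.Quotient.mk_surjective _ t
    obtain ⟨b, hb, l, hl⟩ := hdiv n z (mem_cocycles.1 z.2).1 j
    exact ⟨_, z, b, ⟨d n b, hmem j l z b hb hl⟩, hb, ⟨l, hl⟩, rfl, rfl, rfl⟩
  have hψ : ∀ j, ∃ ψ : Cohomology d S n →ₗ[R] Cohomology d (insert x S) (n + 1),
      ∀ t t', rel j t t' → ψ t = t' := by
    intro j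
    refine exists_linearMap_of_rel (rel j) (total j) ?_ ?_ ?_
    · rintro _ _ _ _ ⟨z, b, z', hb, ⟨l, hl⟩, hz', rfl, rfl⟩ ⟨w, c, w', hc, ⟨k, hk⟩, hw', rfl, rfl⟩
      refine ⟨z + w, b + c, z' + w', add_mem hb hc, ⟨l + k, ?_⟩, ?_, rfl, rfl⟩
      · have : x ^ (l + k) • (x ^ j • (b + c) - ((z + w : cocycles d S n) : I n)) =
            x ^ k • (x ^ l • (x ^ j • b - (z : I n))) +
              x ^ l • (x ^ k • (x ^ j • c - (w : I n))) := by
          rw [Submodule.coe_add]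
          simp only [smul_sub, smul_add, smul_smul, ← pow_add]
          rw [show k + (l + j) = l + k + j by ring, show l + (k + j) = l + k + j by ring,
            add_comm k l]
          abel
        rw [this, hl, hk, smul_zero, smul_zero, add_zero]
      · rw [Submodule.coe_add, hz', hw', map_add]
    · rintro r _ _ ⟨z, b, z', hb, ⟨l, hl⟩, hz', rfl, rfl⟩
      refine ⟨r • z, r • b, r • z', Submodule.smul_mem _ _ hb, ⟨l, ?_⟩, ?_, rfl, rfl⟩
      · rw [Submodule.coe_smul, smul_comm _ r, ← smul_sub, smul_comm _ r, hl, smul_zero]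
      · rw [Submodule.coe_smul, hz', map_smul]
    · exact fun t' ht' => key j 0 ⟨0, by rw [smul_zero]; exact zero_mem _⟩ t' ht'
  choose ψ hψ using hψ
  refine ⟨ψ, ⟨fun j t => ?_, fun t' => ?_, fun j t => ⟨fun ht => ?_, fun ht => ?_⟩⟩⟩
  · obtain ⟨t', ht'⟩ := total j t
    rw [hψ j _ _ ht']
    apply hψ
    obtain ⟨z, b, z', hb, ⟨l, hl⟩, hz', rfl, rfl⟩ := ht'
    refine ⟨x • z, b, z', hb, ⟨l, ?_⟩, hz', rfl, rfl⟩
    rw [Submodule.coe_smul, pow_succ', mul_smul, ← smul_sub, smul_comm, hl, smul_zero]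
  · obtain ⟨z', rfl⟩ := Submodule.Quotient.mk_surjective _ t'
    obtain ⟨b, hb, hdb⟩ := mem_coboundaries_succ.1 (h (cocycles_insert_le x _ z'.2))
    obtain ⟨j, hj⟩ := (mem_powTorsion_insert.1 (mem_cocycles.1 z'.2).1).1
    refine ⟨j, Submodule.Quotient.mk ⟨x ^ j • b, mem_cocycles.2
      ⟨Submodule.smul_mem _ _ hb, by rw [map_smul, hdb, hj]⟩⟩, hψ _ _ _ ?_⟩
    exact ⟨_, b, z', hb, ⟨0, by simp⟩, hdb.symm, rfl, rfl⟩
  · obtain ⟨t', ht'⟩ := total j t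
    rw [hψ j _ _ ht'] at ht
    subst ht
    obtain ⟨z, b, z', hb, ⟨l, hl⟩, hz', rfl, hz0⟩ := ht'
    rw [cohomology_mk_eq_zero, hz', mem_coboundaries_succ] at hz0
    obtain ⟨c, hc, hdc⟩ := hz0
    obtain ⟨⟨q, hq⟩, hcS⟩ := mem_powTorsion_insert.1 hc
    refine ⟨l + q, (Submodule.mem_smul_pointwise_iff_exists _ _ _).2 ⟨Submodule.Quotient.mk
      ⟨b - c, mem_cocycles.2 ⟨sub_mem hb hcS, by rw [map_sub, hdc, sub_self]⟩⟩, trivial, ?_⟩⟩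
    rw [← Submodule.Quotient.mk_smul, ← Submodule.Quotient.mk_smul]
    congr 1
    ext
    change x ^ (j + (l + q)) • (b - c) = x ^ (l + q) • (z : I n)
    rw [smul_sub, pow_smul_eq_zero_of_le (show q ≤ j + (l + q) by omega) hq, sub_zero, ← sub_eq_zero]
    have : x ^ (j + (l + q)) • b - x ^ (l + q) • (z : I n) =
        x ^ q • (x ^ l • (x ^ j • b - (z : I n))) := by
      simp only [smul_sub, smul_smul, ← pow_add]
      rw [show q + (l + j) = j + (l + q) by ring, add_comm q l]
    rw [this, hl, smul_zero]
  · obtain ⟨t', ht'⟩ := total j t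
    rw [hψ j _ _ ht']
    exact key j t ht t' ht'

end Cohomology

/-! ### Powers of a finite family of elements -/

section PowSpan

variable {R : Type*} [CommRing R] {ι : Type*} (x : ι → R)

theorem span_prod_mul_span_pow_le (A : Finset ι) (j : ℕ) :
    Ideal.span {∏ b ∈ A, x b} * Ideal.span ((fun a => x a ^ j) '' A) ≤
      Ideal.span ((fun a => x a ^ (j + 1)) '' A) := by
  rw [Ideal.span_mul_span', Ideal.span_le]
  rintro _ ⟨_, rfl, _, ⟨b, hb, rfl⟩, rfl⟩
  obtain ⟨c, hc⟩ := Finset.dvd_prod_of_mem x hb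
  change (∏ b ∈ A, x b) * x b ^ j ∈ _
  rw [hc, show x b * c * x b ^ j = c * x b ^ (j + 1) by ring]
  exact Ideal.mul_mem_left _ _ (Ideal.subset_span ⟨b, hb, rfl⟩)

open Pointwise in
theorem span_insert_smul_top [DecidableEq ι] {M : Type*} [AddCommGroup M] [Module R M]
    (A : Finset ι) (a : ι) (j : ℕ) :
    Ideal.span ((fun b => x b ^ j) '' (insert a A : Finset ι)) • (⊤ : Submodule R M) =
      Ideal.span ((fun b => x b ^ j) '' A) • (⊤ : Submodule R M) ⊔
        x a ^ j • (⊤ : Submodule R M) := by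
  rw [Finset.coe_insert, Set.image_insert_eq, Ideal.span_insert, Submodule.sup_smul,
    Submodule.ideal_span_singleton_smul, sup_comm]

open Pointwise in
/-- Adjoining one more element `x a` to a family `x_b`, `b ∈ A`, amounts to one more limit over
the powers of `x a`. -/
theorem IsTelescope.comp_insert [DecidableEq ι] {M T T' : Type*} [AddCommGroup M] [Module R M]
    [AddCommGroup T] [Module R T] [AddCommGroup T'] [Module R T'] {A : Finset ι} {a : ι}
    (haA : a ∉ A) {φ : ℕ → M →ₗ[R] T} {ψ : ℕ → T →ₗ[R] T'}
    (hφ : IsTelescope (∏ b ∈ A, x b)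
      (fun j => Ideal.span ((fun b => x b ^ j) '' A) • (⊤ : Submodule R M)) φ)
    (hψ : IsTelescope (x a) (fun j => x a ^ j • (⊤ : Submodule R T)) ψ) :
    IsTelescope (∏ b ∈ insert a A, x b)
      (fun j => Ideal.span ((fun b => x b ^ j) '' (insert a A : Finset ι)) • (⊤ : Submodule R M))
      (fun j => ψ j ∘ₗ φ j) := by
  refine (hφ.comp hψ fun j m hm => ?_).congr (Finset.prod_insert haA).symm fun j =>
    (span_insert_smul_top x A a j).symm
  have := Submodule.smul_mem_smul (Ideal.mem_span_singleton_self (∏ b ∈ A, x b)) hm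
  rw [← Submodule.mul_smul] at this
  exact Submodule.smul_mono_left (span_prod_mul_span_pow_le x A j) this

end PowSpan

/-! ### Cohomology with supports of a resolution -/

section Resolution

variable {R : Type u} [CommRing R] [IsNoetherianRing R] {I : ℕ → Type u}
  [∀ n, AddCommGroup (I n)] [∀ n, Module R (I n)] [∀ n, Module.Injective R (I n)]
  {d : ∀ n, I n →ₗ[R] I (n + 1)} {M : Type u} [AddCommGroup M] [Module R M] {η : M →ₗ[R] I 0}
  (hη : LinearMap.range η = LinearMap.ker (d 0))
  (hd : ∀ n, LinearMap.range (d n) = LinearMap.ker (d (n + 1)))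

include hη hd

/-- If all elements of a finite set `W` act nilpotently on each element of `M`, then `Γ_W` of an
injective resolution of `M` is still a resolution of `M`. -/
theorem cocycles_of_nilpotent {W : Set R} (hW : W.Finite)
    (hnil : ∀ w ∈ W, ∀ m : M, ∃ e : ℕ, w ^ e • m = 0) :
    cocycles d W 0 = LinearMap.range η ∧
      ∀ n, cocycles d W (n + 1) ≤ coboundaries d W (n + 1) := by
  have hdd : ∀ n a, d (n + 1) (d n a) = 0 := fun n a => by
    rw [← LinearMap.mem_ker, ← hd]
    exact ⟨a, rfl⟩
  have h0 : cocycles d W 0 = LinearMap.range η := by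
    rw [hη]
    refine inf_eq_right.2 ?_
    rw [← hη]
    rintro _ ⟨m, rfl⟩ w hw
    obtain ⟨e, he⟩ := hnil w hw m
    exact ⟨e, by rw [← map_smul, he, map_zero]⟩
  refine ⟨h0, ?_⟩
  clear h0
  induction W, hW using Set.Finite.induction_on with
  | empty =>
    rintro n z ⟨-, hz⟩
    rw [← hd] at hz
    obtain ⟨a, rfl⟩ := hz
    exact mem_coboundaries_succ.2 ⟨a, fun r hr => hr.elim, rfl⟩
  | @insert w W _ _ ih =>
    have ih := ih fun v hv => hnil v (Set.mem_insert_of_mem _ hv)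
    intro n
    refine cocycles_le_coboundaries_insert hdd
      (fun n a ha => exists_pow_smul_sub_eq_zero ha w) (ih n) fun z hz => ?_
    cases n with
    | zero =>
      have : z ∈ LinearMap.range η := by rw [hη]; exact hz.2
      obtain ⟨m, rfl⟩ := this
      obtain ⟨e, he⟩ := hnil w (Set.mem_insert _ _) m
      exact ⟨e, by rw [← map_smul, he, map_zero]; exact zero_mem _⟩
    | succ n => exact ⟨0, by simpa using ih n hz⟩

open Pointwise in
/-- Let `I` be an injective resolution of `M`, let `W` be a finite set of elements acting
nilpotently on `M`, and let `x_a`, `a ∈ A`, be further elements. The cohomology of `Γ_{W ∪ x}(I)`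
vanishes above the degree `#A`, and in this degree it is the direct limit of the modules
`M/(x_a^j : a ∈ A)M`. -/
theorem exists_isTelescope_cohomology (hinj : Function.Injective η) {W : Set R} (hW : W.Finite)
    (hnil : ∀ w ∈ W, ∀ m : M, ∃ e : ℕ, w ^ e • m = 0) {ι : Type*} [DecidableEq ι] (x : ι → R)
    (A : Finset ι) (k : ℕ) (hk : A.card = k) (S : Set R) (hS : S = W ∪ x '' A) :
    (∃ φ : ℕ → M →ₗ[R] Cohomology d S k, IsTelescope (∏ a ∈ A, x a)
      (fun j => Ideal.span ((fun a => x a ^ j) '' A) • (⊤ : Submodule R M)) φ) ∧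
    ∀ n, k ≤ n → cocycles d S (n + 1) ≤ coboundaries d S (n + 1) := by
  have hdd : ∀ n a, d (n + 1) (d n a) = 0 := fun n a => by
    rw [← LinearMap.mem_ker, ← hd]
    exact ⟨a, rfl⟩
  induction A using Finset.induction_on generalizing k S with
  | empty =>
    obtain rfl : 0 = k := by simpa using hk
    obtain rfl : S = W := by simpa using hS
    obtain ⟨h0, h1⟩ := cocycles_of_nilpotent hη hd hW hnil
    refine ⟨⟨fun _ => Submodule.mkQ _ ∘ₗ η.codRestrict _ fun m => h0 ▸ ⟨m, rfl⟩,
      ⟨by simp, fun t => ?_, fun j m => ?_⟩⟩, fun n _ => h1 n⟩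
    · obtain ⟨⟨z, hz⟩, rfl⟩ := Submodule.mkQ_surjective _ t
      obtain ⟨m, rfl⟩ : z ∈ LinearMap.range η := h0 ▸ hz
      exact ⟨0, m, rfl⟩
    · rw [LinearMap.comp_apply, Submodule.mkQ_apply, cohomology_mk_eq_zero, mem_coboundaries_zero]
      simp [map_eq_zero_iff η hinj]
  | insert a A haA ih =>
    obtain ⟨k, rfl⟩ : ∃ l, k = l + 1 := ⟨A.card, by rw [← hk, Finset.card_insert_of_notMem haA]⟩
    obtain ⟨⟨φ, hφ⟩, hvan⟩ := ih k (by
      rw [Finset.card_insert_of_notMem haA] at hk; omega) _ rfl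
    have hS' : S = insert (x a) (W ∪ x '' A) := by
      rw [hS, Finset.coe_insert, Set.image_insert_eq, Set.union_insert]
    have hdiv : ∀ (n : ℕ) (b : I n), b ∈ powTorsion (W ∪ x '' A) (I n) → ∀ j : ℕ,
        ∃ c ∈ powTorsion (W ∪ x '' A) (I n), ∃ l : ℕ, x a ^ l • (x a ^ j • c - b) = 0 :=
      fun n b hb => exists_pow_smul_sub_eq_zero hb (x a)
    subst hS'
    obtain ⟨ψ, hψ⟩ := exists_isTelescope_insert hdd hdiv (hvan k le_rfl)
    refine ⟨⟨_, hφ.comp_insert x haA hψ⟩, fun n hn => ?_⟩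
    obtain ⟨n, rfl⟩ : ∃ l, n = l + 1 := ⟨n - 1, by omega⟩
    refine cocycles_le_coboundaries_insert hdd hdiv (hvan _ (by omega)) fun z hz => ⟨0, ?_⟩
    simpa using hvan n (by omega) hz

end Resolution

/-! ### Comparison of the two constructions of `Ext` -/

section ExtComparison

open CategoryTheory Limits Opposite

variable {R : Type u} [CommRing R]

theorem cochainComplex_homologyπ_surjective (K : CochainComplex (ModuleCat.{u} R) ℕ) (n : ℕ)
    (t : K.homology n) : ∃ z : K.cycles n, (K.homologyπ n).hom z = t :=
  (ModuleCat.epi_iff_surjective _).1 inferInstance t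

theorem cochainComplex_exists_toCycles (K : CochainComplex (ModuleCat.{u} R) ℕ) (n : ℕ)
    (z : K.cycles n) (hz : (K.homologyπ n).hom z = 0) :
    ∃ g : K.X ((ComplexShape.up ℕ).prev n), (K.toCycles _ n).hom g = z := by
  have h := ShortComplex.exact_of_g_is_cokernel (ShortComplex.mk _ _ (K.toCycles_comp_homologyπ _ n))
    (K.homologyIsCokernel _ n rfl)
  rw [ShortComplex.moduleCat_exact_iff] at h
  exact h z hz

theorem cochainComplex_iCycles_injective (K : CochainComplex (ModuleCat.{u} R) ℕ) (n : ℕ) :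
    Function.Injective (K.iCycles n).hom :=
  (ModuleCat.mono_iff_injective _).1 inferInstance

theorem cochainComplex_iCycles_toCycles (K : CochainComplex (ModuleCat.{u} R) ℕ) (m n : ℕ)
    (g : K.X m) : (K.iCycles n).hom ((K.toCycles m n).hom g) = (K.d m n).hom g := by
  rw [← K.toCycles_i m n]
  rfl

theorem cochainComplex_exists_iCycles (K : CochainComplex (ModuleCat.{u} R) ℕ) (n : ℕ)
    (f : K.X n) (hf : (K.d n (n + 1)).hom f = 0) : ∃ z : K.cycles n, (K.iCycles n).hom z = f := by
  have h := ShortComplex.exact_of_f_is_kernel (ShortComplex.mk _ _ (K.iCycles_d n (n + 1)))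
    (K.cyclesIsKernel n (n + 1) (by simp))
  rw [ShortComplex.moduleCat_exact_iff] at h
  exact h f hf

variable {X Y : ModuleCat.{u} R} (P : ProjectiveResolution X) (n : ℕ)

/-- The cocycle `f : P_n ⟶ Y` represents the class `t` in `Ext^n(X, Y)`, computed as a left
derived functor in the first argument. -/
def Represents (f : P.complex.X n ⟶ Y) (t : ((Ext R (ModuleCat.{u} R) n).obj (op X)).obj Y) :
    Prop :=
  ∃ z : (P.complex.linearYonedaObj R Y).cycles n,
    ((P.complex.linearYonedaObj R Y).iCycles n).hom z = f ∧
      (P.isoExt n Y).hom.hom t = ((P.complex.linearYonedaObj R Y).homologyπ n).hom z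

variable {P n}

theorem Represents.d_comp {f : P.complex.X n ⟶ Y}
    {t : ((Ext R (ModuleCat.{u} R) n).obj (op X)).obj Y} (h : Represents P n f t) :
    P.complex.d (n + 1) n ≫ f = 0 := by
  obtain ⟨z, rfl, -⟩ := h
  exact congrArg (fun k => k.hom z) ((P.complex.linearYonedaObj R Y).iCycles_d n (n + 1))

variable (P n)

theorem exists_represents (t : ((Ext R (ModuleCat.{u} R) n).obj (op X)).obj Y) :
    ∃ f, Represents P n f t := by
  obtain ⟨z, hz⟩ := cochainComplex_homologyπ_surjective _ n ((P.isoExt n Y).hom.hom t)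
  exact ⟨_, z, rfl, hz.symm⟩

theorem exists_represented_class (f : P.complex.X n ⟶ Y) (hf : P.complex.d (n + 1) n ≫ f = 0) :
    ∃ t, Represents P n f t := by
  obtain ⟨z, hz⟩ := cochainComplex_exists_iCycles (P.complex.linearYonedaObj R Y) n f hf
  exact ⟨(P.isoExt n Y).inv.hom (((P.complex.linearYonedaObj R Y).homologyπ n).hom z), z, hz,
    Iso.inv_hom_id_apply (P.isoExt n Y) _⟩

variable {P n}

theorem Represents.add {f f' : P.complex.X n ⟶ Y}
    {t t' : ((Ext R (ModuleCat.{u} R) n).obj (op X)).obj Y} (h : Represents P n f t)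
    (h' : Represents P n f' t') : Represents P n (f + f') (t + t') := by
  obtain ⟨z, rfl, hz⟩ := h
  obtain ⟨z', rfl, hz'⟩ := h'
  exact ⟨z + z', map_add _ _ _, by rw [map_add, map_add, hz, hz']⟩

theorem Represents.smul (r : R) {f : P.complex.X n ⟶ Y}
    {t : ((Ext R (ModuleCat.{u} R) n).obj (op X)).obj Y} (h : Represents P n f t) :
    Represents P n (r • f) (r • t) := by
  obtain ⟨z, rfl, hz⟩ := h
  exact ⟨r • z, map_smul _ _ _, by rw [map_smul, map_smul, hz]⟩

/-- In positive degrees, the class represented by a cocycle vanishes if and only if the cocycle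
is a coboundary. -/
theorem Represents.eq_zero_iff_succ {f : P.complex.X (n + 1) ⟶ Y}
    {t : ((Ext R (ModuleCat.{u} R) (n + 1)).obj (op X)).obj Y} (h : Represents P (n + 1) f t) :
    t = 0 ↔ ∃ g : P.complex.X n ⟶ Y, P.complex.d (n + 1) n ≫ g = f := by
  obtain ⟨z, rfl, hz⟩ := h
  constructor
  · rintro rfl
    rw [map_zero] at hz
    obtain ⟨g, rfl⟩ := cochainComplex_exists_toCycles _ _ z hz.symm
    rw [cochainComplex_iCycles_toCycles]
    revert g
    rw [CochainComplex.prev_nat_succ]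
    exact fun g _ => ⟨g, rfl⟩
  · rintro ⟨g, hg⟩
    have : z = ((P.complex.linearYonedaObj R Y).toCycles n (n + 1)).hom g := by
      apply cochainComplex_iCycles_injective
      exact Eq.trans hg.symm
        (cochainComplex_iCycles_toCycles (P.complex.linearYonedaObj R Y) n (n + 1) g).symm
    have h0 : (P.isoExt (n + 1) Y).hom.hom t = 0 := by
      rw [hz, this]
      exact congrArg (fun k => k.hom g)
        ((P.complex.linearYonedaObj R Y).toCycles_comp_homologyπ n (n + 1))
    have := congrArg (fun k => k.hom t) (P.isoExt (n + 1) Y).hom_inv_id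
    change (P.isoExt (n + 1) Y).inv.hom ((P.isoExt (n + 1) Y).hom.hom t) = t at this
    rw [← this, h0, map_zero]

theorem Represents.eq_zero_iff_zero {f : P.complex.X 0 ⟶ Y}
    {t : ((Ext R (ModuleCat.{u} R) 0).obj (op X)).obj Y} (h : Represents P 0 f t) :
    t = 0 ↔ f = 0 := by
  obtain ⟨z, rfl, hz⟩ := h
  constructor
  · rintro rfl
    rw [map_zero] at hz
    obtain ⟨g, rfl⟩ := cochainComplex_exists_toCycles _ _ z hz.symm
    rw [cochainComplex_iCycles_toCycles, (P.complex.linearYonedaObj R Y).shape _ _ (by simp)]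
    rfl
  · intro h0
    have : z = 0 := cochainComplex_iCycles_injective _ _ (h0.trans (map_zero _).symm)
    rw [this, map_zero] at hz
    have := congrArg (fun k => k.hom t) (P.isoExt 0 Y).hom_inv_id
    change (P.isoExt 0 Y).inv.hom ((P.isoExt 0 Y).hom.hom t) = t at this
    rw [← this, hz, map_zero]

/-- The cochain map `Hom(P, Y) → Hom(P', Y)` induced by a chain map `P' → P`. -/
noncomputable def linearYonedaMap {K L : ChainComplex (ModuleCat.{u} R) ℕ} (φ : K ⟶ L)
    (Y : ModuleCat.{u} R) : L.linearYonedaObj R Y ⟶ K.linearYonedaObj R Y :=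
  (HomologicalComplex.unopFunctor _ _).map
    ((((linearYoneda R (ModuleCat.{u} R)).obj Y).rightOp.mapHomologicalComplex _).map φ).op

/-- `ProjectiveResolution.isoExt` is natural in the first argument. -/
theorem isoExt_naturality {X' : ModuleCat.{u} R} {P' : ProjectiveResolution X'} {g : X' ⟶ X}
    (φ : ProjectiveResolution.Hom P' P g) :
    ((Ext R (ModuleCat.{u} R) n).map g.op).app Y ≫ (P'.isoExt n Y).hom =
      (P.isoExt n Y).hom ≫ HomologicalComplex.homologyMap (linearYonedaMap φ.hom Y) n := by
  -- both isomorphisms composing `isoExt` are natural; they are transported from the opposite category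
  have aux : ∀ {A A' B B' D D' : ModuleCat.{u} R} (a : A ⟶ A') (b : A ⟶ B) (b' : A' ⟶ B')
      (m : B ⟶ B') (o : D ≅ B) (o' : D' ≅ B') (h : D ⟶ D'), a ≫ b' = b ≫ m →
      o.hom ≫ m = h ≫ o'.hom → a ≫ b' ≫ o'.inv = (b ≫ o.inv) ≫ h := by
    intro A A' B B' D D' a b b' m o o' h h3 h4
    rw [reassoc_of% h3, Category.assoc]
    congr 1
    rw [Iso.eq_inv_comp, reassoc_of% h4, Iso.hom_inv_id, Category.comp_id]
  exact aux _ _ _ _ ((P.complex.linearYonedaObj R Y).homologyOp n).unop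
    ((P'.complex.linearYonedaObj R Y).homologyOp n).unop _
    (congrArg Quiver.Hom.unop (ProjectiveResolution.isoLeftDerivedObj_inv_naturality g P' P φ.hom
      φ.hom_f_zero_comp_π_f_zero ((linearYoneda R (ModuleCat.{u} R)).obj Y).rightOp n))
    (congrArg Quiver.Hom.unop
      (HomologicalComplex.homologyOp_hom_naturality (linearYonedaMap φ.hom Y) n))

theorem Represents.map {X' : ModuleCat.{u} R} {P' : ProjectiveResolution X'} {g : X' ⟶ X}
    (φ : ProjectiveResolution.Hom P' P g) {f : P.complex.X n ⟶ Y}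
    {t : ((Ext R (ModuleCat.{u} R) n).obj (op X)).obj Y} (h : Represents P n f t) :
    Represents P' n (φ.hom.f n ≫ f) ((((Ext R (ModuleCat.{u} R) n).map g.op).app Y).hom t) := by
  obtain ⟨z, rfl, hz⟩ := h
  refine ⟨(HomologicalComplex.cyclesMap (linearYonedaMap φ.hom Y) n).hom z, ?_, ?_⟩
  · exact congrArg (fun k => k.hom z)
      (HomologicalComplex.cyclesMap_i (linearYonedaMap φ.hom Y) n)
  · have h1 := congrArg (fun k => k.hom t) (isoExt_naturality (n := n) (Y := Y) φ)
    have h2 := congrArg (fun k => k.hom z)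
      (HomologicalComplex.homologyπ_naturality (linearYonedaMap φ.hom Y) n)
    refine h1.trans (Eq.trans ?_ h2)
    exact congrArg (HomologicalComplex.homologyMap (linearYonedaMap φ.hom Y) n).hom hz

end ExtComparison

section ExtVanishing

open CategoryTheory CochainComplex HomComplex Abelian

variable {C : Type*} [Category* C] [Abelian C] [HasExt.{u} C] {X Y : C}

/-- There are no nonzero coboundaries in degree `0`. -/
theorem _root_.CategoryTheory.ProjectiveResolution.extMk_zero_eq_zero_iff
    (P : ProjectiveResolution X) (f : P.complex.X 0 ⟶ Y) (hf : P.complex.d 1 0 ≫ f = 0) :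
    P.extMk f 1 rfl hf = 0 ↔ f = 0 := by
  refine ⟨fun h => ?_, fun h => by subst h; exact P.extMk_zero 1 rfl⟩
  simp only [← P.extEquivCohomologyClass.apply_eq_iff_eq,
    ProjectiveResolution.extEquivCohomologyClass_extMk,
    ProjectiveResolution.extEquivCohomologyClass_zero, CohomologyClass.mk_eq_zero_iff] at h
  rw [Cocycle.toSingleMk_mem_coboundaries_iff _ _ _ _ _ 1 (by simp)] at h
  obtain ⟨g, hg⟩ := h
  have h0 : Limits.IsZero (P.cochainComplex.X 1) :=
    CochainComplex.isZero_of_isStrictlyLE _ 0 _ (by lia)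
  rw [h0.eq_of_src g 0, Limits.comp_zero] at hg
  rw [← cancel_epi (P.cochainComplexXIso (-(0 : ℕ)) 0 rfl).hom, Limits.comp_zero]
  exact hg.symm

/-- There are no nonzero coboundaries in degree `0`. -/
theorem _root_.CategoryTheory.InjectiveResolution.extMk_zero_eq_zero_iff
    (J : InjectiveResolution Y) (f : X ⟶ J.cocomplex.X 0) (hf : f ≫ J.cocomplex.d 0 1 = 0) :
    J.extMk f 1 rfl hf = 0 ↔ f = 0 := by
  refine ⟨fun h => ?_, fun h => by subst h; exact J.extMk_zero 1 rfl⟩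
  simp only [← J.extEquivCohomologyClass.apply_eq_iff_eq,
    InjectiveResolution.extEquivCohomologyClass_extMk,
    InjectiveResolution.extEquivCohomologyClass_zero, CohomologyClass.mk_eq_zero_iff] at h
  rw [Cocycle.fromSingleMk_mem_coboundaries_iff _ _ _ _ _ (-1) (by simp)] at h
  obtain ⟨g, hg⟩ := h
  have h0 : Limits.IsZero (J.cochainComplex.X (-1)) :=
    CochainComplex.isZero_of_isStrictlyGE _ 0 _ (by lia)
  rw [h0.eq_of_tgt g 0, Limits.zero_comp] at hg
  rw [← cancel_mono (J.cochainComplexXIso (0 : ℕ) 0 rfl).inv, Limits.zero_comp]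
  exact hg.symm

end ExtVanishing

section ExtIso

open CategoryTheory Opposite

variable {R : Type u} [CommRing R] {X Y : ModuleCat.{u} R} {n : ℕ}

theorem smul_projective_extMk (P : ProjectiveResolution X) (r : R) (f : P.complex.X n ⟶ Y)
    (hf : P.complex.d (n + 1) n ≫ f = 0) :
    r • P.extMk f (n + 1) rfl hf = P.extMk (r • f) (n + 1) rfl (by simp [hf]) := by
  rw [Abelian.Ext.smul_eq_comp_mk₀, ProjectiveResolution.extMk_comp_mk₀]
  congr 1

theorem smul_injective_extMk (J : InjectiveResolution Y) (r : R) (f : X ⟶ J.cocomplex.X n)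
    (hf : f ≫ J.cocomplex.d n (n + 1) = 0) :
    r • J.extMk f (n + 1) rfl hf = J.extMk (r • f) (n + 1) rfl (by simp [hf]) := by
  have h : (Abelian.Ext.mk₀ (r • 𝟙 X)).comp (J.extMk f (n + 1) rfl hf) (zero_add n) =
      r • J.extMk f (n + 1) rfl hf := by
    rw [Abelian.Ext.mk₀_smul, Abelian.Ext.smul_comp, Abelian.Ext.mk₀_id_comp]
  rw [← h, InjectiveResolution.mk₀_comp_extMk]
  congr 1
  simp

/-- The two constructions of `Ext^n(X, Y)`, as a left derived functor of `Hom(-, Y)` and as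
morphisms in the derived category, agree, naturally in `X`. -/
theorem exists_extEquiv (Y : ModuleCat.{u} R) (n : ℕ) :
    ∃ L : ∀ X : ModuleCat.{u} R,
      ((Ext R (ModuleCat.{u} R) n).obj (op X)).obj Y ≃ₗ[R] Abelian.Ext X Y n,
    ∀ (X X' : ModuleCat.{u} R) (g : X' ⟶ X) (t : ((Ext R (ModuleCat.{u} R) n).obj (op X)).obj Y),
      L X' ((((Ext R (ModuleCat.{u} R) n).map g.op).app Y).hom t) =
        (Abelian.Ext.mk₀ g).comp (L X t) (zero_add n) := by
  have key : ∀ X : ModuleCat.{u} R, ∃ L : ((Ext R (ModuleCat.{u} R) n).obj (op X)).obj Y ≃ₗ[R]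
      Abelian.Ext X Y n, ∀ t f (h : Represents (projectiveResolution X) n f t),
        L t = (projectiveResolution X).extMk f (n + 1) rfl h.d_comp := by
    intro X
    set P := projectiveResolution X
    have hzero : ∀ (t : ((Ext R (ModuleCat.{u} R) n).obj (op X)).obj Y) (f : P.complex.X n ⟶ Y)
        (h : Represents P n f t), t = 0 ↔ P.extMk f (n + 1) rfl h.d_comp = 0 := by
      intro t f h
      cases n with
      | zero => rw [h.eq_zero_iff_zero, P.extMk_zero_eq_zero_iff]
      | succ n => rw [h.eq_zero_iff_succ, P.extMk_eq_zero_iff _ _ _ _ n rfl]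
    obtain ⟨L, hL⟩ := exists_linearMap_of_rel (R := R)
      (fun (t : ((Ext R (ModuleCat.{u} R) n).obj (op X)).obj Y) (α : Abelian.Ext X Y n) =>
        ∃ (f : P.complex.X n ⟶ Y) (h : Represents P n f t), P.extMk f (n + 1) rfl h.d_comp = α)
      (fun t => by
        obtain ⟨f, h⟩ := exists_represents P n t
        exact ⟨_, f, h, rfl⟩)
      (by
        rintro t _ t' _ ⟨f, h, rfl⟩ ⟨f', h', rfl⟩
        exact ⟨f + f', h.add h', (P.add_extMk _ _ _ _ _ _).symm⟩)
      (by
        rintro r t _ ⟨f, h, rfl⟩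
        exact ⟨r • f, h.smul r, (smul_projective_extMk _ _ _ _).symm⟩)
      (by
        rintro _ ⟨f, h, rfl⟩
        exact (hzero _ _ h).1 rfl)
    have hL' : ∀ t f (h : Represents P n f t), L t = P.extMk f (n + 1) rfl h.d_comp :=
      fun t f h => hL _ _ ⟨f, h, rfl⟩
    refine ⟨LinearEquiv.ofBijective L ⟨?_, fun α => ?_⟩, hL'⟩
    · rw [← LinearMap.ker_eq_bot, LinearMap.ker_eq_bot']
      intro t ht
      obtain ⟨f, h⟩ := exists_represents P n t
      exact (hzero t f h).2 ((hL' t f h).symm.trans ht)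
    · obtain ⟨f, hf, rfl⟩ := P.extMk_surjective α (n + 1) rfl
      obtain ⟨t, h⟩ := exists_represented_class P n f hf
      exact ⟨t, hL' t f h⟩
  choose L hL using key
  refine ⟨L, fun X X' g t => ?_⟩
  obtain ⟨f, h⟩ := exists_represents (projectiveResolution X) n t
  let φ : ProjectiveResolution.Hom (projectiveResolution X') (projectiveResolution X) g :=
    ⟨ProjectiveResolution.lift g _ _, ProjectiveResolution.lift_commutes_zero g _ _⟩
  rw [hL _ _ _ h, hL _ _ _ (h.map φ), ProjectiveResolution.mk₀_comp_extMk _ _ _ _ φ]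

end ExtIso

/-! ### Local cohomology via injective resolutions -/

section LocalCohomologyInjective

open CategoryTheory Limits Opposite

variable {R : Type u} [CommRing R]

/-- The module `R/J^e`, as it occurs in the definition of local cohomology. -/
abbrev powQuotient (J : Ideal R) (e : ℕ) : ModuleCat.{u} R := ModuleCat.of R (R ⧸ J ^ e)

/-- The projection `R/J^f ⟶ R/J^e`. -/
noncomputable abbrev powQuotientMap (J : Ideal R) {e f : ℕ} (h : e ≤ f) :
    powQuotient J f ⟶ powQuotient J e :=
  (localCohomology.ringModIdeals (localCohomology.idealPowersDiagram J)).map (homOfLE h).op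

theorem powQuotient_hom_ext {J : Ideal R} {e : ℕ} {N : ModuleCat.{u} R}
    {f g : powQuotient J e ⟶ N}
    (h : f.hom (Submodule.Quotient.mk 1) = g.hom (Submodule.Quotient.mk 1)) : f = g := by
  refine ModuleCat.hom_ext (LinearMap.ext fun x => ?_)
  obtain ⟨r, rfl⟩ := Submodule.Quotient.mk_surjective _ x
  have : (Submodule.Quotient.mk r : R ⧸ J ^ e) = r • Submodule.Quotient.mk 1 := by
    rw [← Submodule.Quotient.mk_smul, smul_eq_mul, mul_one]
  rw [this]
  exact ((f.hom.map_smul _ _).trans (congrArg (r • ·) h)).trans (g.hom.map_smul _ _).symm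

theorem exists_powQuotient_hom {J : Ideal R} {e : ℕ} {N : ModuleCat.{u} R} {a : N}
    (ha : ∀ r ∈ J ^ e, r • a = 0) :
    ∃ f : powQuotient J e ⟶ N, f.hom (Submodule.Quotient.mk 1) = a :=
  ⟨ModuleCat.ofHom ((J ^ e).liftQ (LinearMap.toSpanSingleton R N a) ha), one_smul _ _⟩

theorem powQuotient_hom_mem_powTorsion {J : Ideal R} {e : ℕ} {N : ModuleCat.{u} R}
    (f : powQuotient J e ⟶ N) : f.hom (Submodule.Quotient.mk 1) ∈ powTorsion (J : Set R) N := by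
  intro r hr
  refine ⟨e, ?_⟩
  rw [← map_smul, ← Submodule.Quotient.mk_smul, smul_eq_mul, mul_one,
    (Submodule.Quotient.mk_eq_zero _).2 (Ideal.pow_mem_pow hr e), map_zero]

variable [IsNoetherianRing R] (J : Ideal R) {Y : ModuleCat.{u} R}
  (E : InjectiveResolution Y) (n : ℕ)

/-- Local cohomology with support in `J` is the cohomology of the `J`-torsion of an injective
resolution. -/
theorem nonempty_cohomology_equiv_localCohomology :
    Nonempty (Cohomology (I := fun n => E.cocomplex.X n)
      (fun n => (E.cocomplex.d n (n + 1)).hom) (J : Set R) n ≃ₗ[R]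
        (localCohomology J n).obj Y) := by
  set d : ∀ n, E.cocomplex.X n →ₗ[R] E.cocomplex.X (n + 1) :=
    fun n => (E.cocomplex.d n (n + 1)).hom
  obtain ⟨L, hL⟩ := exists_extEquiv Y n
  let F : (ℕᵒᵖ)ᵒᵖ ⥤ ModuleCat.{u} R :=
    localCohomology.diagram (localCohomology.idealPowersDiagram J) n ⋙ (evaluation _ _).obj Y
  let c : Cocone F := ((evaluation _ _).obj Y).mapCocone
    (colimit.cocone (localCohomology.diagram (localCohomology.idealPowersDiagram J) n))
  have hc : IsColimit c := isColimitOfPreserves ((evaluation _ _).obj Y)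
    (colimit.isColimit (localCohomology.diagram (localCohomology.idealPowersDiagram J) n))
  have : PreservesFilteredColimitsOfSize.{0, 0} (forget (ModuleCat.{u} R)) :=
    preservesSmallestFilteredColimits_of_preservesFilteredColimits _
  change Nonempty (_ ≃ₗ[R] c.pt)
  -- the map from `Ext^n(R/J^e, Y)` to the colimit
  let ι : ∀ e : ℕ, Abelian.Ext (powQuotient J e) Y n →ₗ[R] c.pt := fun e =>
    (c.ι.app (op (op e))).hom ∘ₗ (L (powQuotient J e)).symm.toLinearMap
  have hmap : ∀ {e f : ℕ} (h : e ≤ f) (α : Abelian.Ext (powQuotient J e) Y n),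
      (L (powQuotient J f)).symm ((Abelian.Ext.mk₀ (powQuotientMap J h)).comp α (zero_add n)) =
        (F.map (homOfLE h).op.op).hom ((L (powQuotient J e)).symm α) := by
    intro e f h α
    refine (LinearEquiv.symm_apply_eq _).2 ?_
    have := hL _ _ (powQuotientMap J h) ((L (powQuotient J e)).symm α)
    rw [LinearEquiv.apply_symm_apply] at this
    exact this.symm
  have hι : ∀ {e f : ℕ} (h : e ≤ f) (α : Abelian.Ext (powQuotient J e) Y n),
      ι f ((Abelian.Ext.mk₀ (powQuotientMap J h)).comp α (zero_add n)) = ι e α := by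
    intro e f h α
    have h1 := congrArg (fun k => k.hom ((L (powQuotient J e)).symm α))
      (c.w (homOfLE h).op.op)
    change (c.ι.app (op (op f))).hom ((L (powQuotient J f)).symm _) = _
    rw [hmap h]
    exact h1
  have hsurj : ∀ t : c.pt, ∃ e α, ι e α = t := by
    intro t
    obtain ⟨j, y, hy⟩ := Concrete.isColimit_exists_rep F hc t
    exact ⟨j.unop.unop, L (powQuotient J j.unop.unop) y, (congrArg (c.ι.app j).hom
      (LinearEquiv.symm_apply_apply (L (powQuotient J j.unop.unop)) y)).trans hy⟩
  have hker : ∀ e α, ι e α = 0 → ∃ (f : ℕ) (h : e ≤ f),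
      (Abelian.Ext.mk₀ (powQuotientMap J h)).comp α (zero_add n) = 0 := by
    intro e α h0
    obtain ⟨k, f, g, hfg⟩ := Concrete.isColimit_exists_of_rep_eq F hc (i := op (op e))
      (j := op (op e)) ((L (powQuotient J e)).symm α) 0 (h0.trans (map_zero _).symm)
    have hle : e ≤ k.unop.unop := leOfHom f.unop.unop
    refine ⟨k.unop.unop, hle, (L _).symm.injective ?_⟩
    rw [hmap, map_zero]
    exact hfg.trans (map_zero (F.map g).hom)
  -- the class of a cocycle killed by `J ^ e`, as an extension of `R/J^e`
  have hcls : ∀ {e f : ℕ} (h : e ≤ f) (k : powQuotient J e ⟶ E.cocomplex.X n)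
      (hk : k ≫ E.cocomplex.d n (n + 1) = 0),
      ι f (E.extMk (powQuotientMap J h ≫ k) (n + 1) rfl (by rw [Category.assoc, hk, comp_zero])) =
        ι e (E.extMk k (n + 1) rfl hk) := by
    intro e f h k hk
    rw [← hι h, InjectiveResolution.mk₀_comp_extMk]
  have hzero : ∀ (e : ℕ) (k : powQuotient J e ⟶ E.cocomplex.X n)
      (hk : k ≫ E.cocomplex.d n (n + 1) = 0), ι e (E.extMk k (n + 1) rfl hk) = 0 ↔
        k.hom (Submodule.Quotient.mk 1) ∈ coboundaries d (J : Set R) n := by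
    intro e k hk
    cases n with
    | zero =>
      rw [mem_coboundaries_zero]
      constructor
      · intro h0
        obtain ⟨f, h, hf⟩ := hker e _ h0
        rw [InjectiveResolution.mk₀_comp_extMk, E.extMk_zero_eq_zero_iff] at hf
        exact congrArg (fun k => k.hom (Submodule.Quotient.mk 1)) hf
      · intro h0
        rw [(E.extMk_zero_eq_zero_iff k hk).2 (powQuotient_hom_ext h0), map_zero]
    | succ n =>
      rw [mem_coboundaries_succ]
      constructor
      · intro h0
        obtain ⟨f, h, hf⟩ := hker e _ h0
        rw [InjectiveResolution.mk₀_comp_extMk, E.extMk_eq_zero_iff _ _ _ _ n rfl] at hf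
        obtain ⟨g, hg⟩ := hf
        exact ⟨g.hom (Submodule.Quotient.mk 1), powQuotient_hom_mem_powTorsion g,
          congrArg (fun k => k.hom (Submodule.Quotient.mk 1)) hg⟩
      · rintro ⟨a, ha, hak⟩
        obtain ⟨f, hf⟩ := exists_pow_smul_eq_zero ha
        obtain ⟨g, hg⟩ := exists_powQuotient_hom (e := max e f) (N := E.cocomplex.X n) (a := a)
          fun r hr => hf r (Ideal.pow_le_pow_right (le_max_right _ _) hr)
        rw [← hcls (le_max_left e f) k hk, (E.extMk_eq_zero_iff _ _ _ _ n rfl).2, map_zero]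
        refine ⟨g, powQuotient_hom_ext ?_⟩
        exact (congrArg (d n) hg).trans hak
  -- every `J`-torsion cocycle is killed by some `J ^ e`; its class does not depend on `e`
  obtain ⟨π, hπ⟩ := exists_linearMap_of_rel (R := R)
    (fun (z : cocycles (I := fun n => E.cocomplex.X n) d (J : Set R) n) (t : c.pt) =>
      ∃ (e : ℕ) (k : powQuotient J e ⟶ E.cocomplex.X n) (hk : k ≫ E.cocomplex.d n (n + 1) = 0),
        k.hom (Submodule.Quotient.mk 1) = z ∧ ι e (E.extMk k (n + 1) rfl hk) = t)
    (by
      rintro ⟨z, hz⟩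
      obtain ⟨hzJ, hdz⟩ := mem_cocycles.1 hz
      obtain ⟨e, he⟩ := exists_pow_smul_eq_zero hzJ
      obtain ⟨k, hk⟩ := exists_powQuotient_hom he
      refine ⟨_, e, k, powQuotient_hom_ext ?_, hk, rfl⟩
      exact (congrArg (d n) hk).trans hdz)
    (by
      rintro z _ z' _ ⟨e, k, hk, hkz, rfl⟩ ⟨e', k', hk', hkz', rfl⟩
      refine ⟨max e e', powQuotientMap J (le_max_left e e') ≫ k +
        powQuotientMap J (le_max_right e e') ≫ k', by
          rw [Preadditive.add_comp, Category.assoc, Category.assoc, hk, hk', comp_zero, comp_zero,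
            add_zero], ?_, ?_⟩
      · exact congrArg₂ (· + ·) hkz hkz'
      · rw [← hcls (le_max_left e e') k hk, ← hcls (le_max_right e e') k' hk', ← map_add,
          E.add_extMk])
    (by
      rintro r z _ ⟨e, k, hk, hkz, rfl⟩
      refine ⟨e, r • k, by rw [Linear.smul_comp, hk, smul_zero], congrArg (r • ·) hkz, ?_⟩
      rw [← map_smul, smul_injective_extMk])
    (by
      rintro _ ⟨e, k, hk, hkz, rfl⟩
      rw [hzero, hkz]
      exact zero_mem _)
  have hπsurj : Function.Surjective π := by
    intro t
    obtain ⟨e, α, rfl⟩ := hsurj t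
    obtain ⟨k, hk, rfl⟩ := E.extMk_surjective α (n + 1) rfl
    refine ⟨⟨k.hom (Submodule.Quotient.mk 1), mem_cocycles.2
      ⟨powQuotient_hom_mem_powTorsion k, congrArg (fun k => k.hom (Submodule.Quotient.mk 1)) hk⟩⟩,
      hπ _ _ ⟨e, k, hk, rfl, rfl⟩⟩
  have hπker : (coboundaries d (J : Set R) n).submoduleOf (cocycles d (J : Set R) n) =
      LinearMap.ker π := by
    ext ⟨z, hz⟩
    obtain ⟨hzJ, hdz⟩ := mem_cocycles.1 hz
    obtain ⟨e, he⟩ := exists_pow_smul_eq_zero hzJ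
    obtain ⟨k, hk⟩ := exists_powQuotient_hom he
    have hkd : k ≫ E.cocomplex.d n (n + 1) = 0 :=
      powQuotient_hom_ext ((congrArg (d n) hk).trans hdz)
    rw [LinearMap.mem_ker, hπ ⟨z, hz⟩ _ ⟨e, k, hkd, hk, rfl⟩, hzero, hk]
    rfl
  exact ⟨(Submodule.quotEquivOfEq _ _ hπker).trans (π.quotKerEquivOfSurjective hπsurj)⟩

end LocalCohomologyInjective

/-! ### Top local cohomology as a direct limit -/

section LocalCohomologyTelescope

open CategoryTheory Limits

variable {R : Type u} [CommRing R]

/-- An injective resolution of `Y` as an exact sequence of linear maps `0 → Y → E^0 → E^1 → ⋯`. -/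
theorem injectiveResolution_exact {Y : ModuleCat.{u} R} (E : InjectiveResolution Y) :
    ∃ η : Y →ₗ[R] E.cocomplex.X 0, Function.Injective η ∧
      LinearMap.range η = LinearMap.ker (E.cocomplex.d 0 1).hom ∧
      ∀ n, LinearMap.range (E.cocomplex.d n (n + 1)).hom =
        LinearMap.ker (E.cocomplex.d (n + 1) (n + 2)).hom := by
  refine ⟨(E.ι.f 0).hom, ?_, ?_, fun n => ?_⟩
  · exact (ModuleCat.mono_iff_injective (E.ι.f 0)).1 inferInstance
  · have := ShortComplex.exact_of_f_is_kernel
      (ShortComplex.mk _ _ E.ι_f_zero_comp_complex_d) E.isLimitKernelFork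
    exact (ShortComplex.moduleCat_exact_iff_range_eq_ker _).1 this
  · exact (ShortComplex.moduleCat_exact_iff_range_eq_ker _).1 (E.exact_succ n)

instance {Y : ModuleCat.{u} R} (E : InjectiveResolution Y) (n : ℕ) :
    Module.Injective R (E.cocomplex.X n) :=
  have : Injective (ModuleCat.of R (E.cocomplex.X n)) := E.injective n
  Module.injective_module_of_injective_object R (E.cocomplex.X n)

theorem nonempty_cohomology_equiv_of_radical_eq {I : ℕ → Type u} [∀ n, AddCommGroup (I n)]
    [∀ n, Module R (I n)] (d : ∀ n, I n →ₗ[R] I (n + 1)) {S S' : Set R}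
    (h : (Ideal.span S).radical = (Ideal.span S').radical) (n : ℕ) :
    Nonempty (Cohomology d S n ≃ₗ[R] Cohomology d S' n) := by
  have h1 : cocycles d S n = cocycles d S' n := by
    rw [cocycles, cocycles, powTorsion_eq_of_radical_eq h]
  have h2 : coboundaries d S n = coboundaries d S' n := by
    cases n with
    | zero => rfl
    | succ n => rw [coboundaries, coboundaries, powTorsion_eq_of_radical_eq h]
  refine ⟨Submodule.Quotient.equiv _ _ (LinearEquiv.ofEq _ _ h1) ?_⟩
  ext z
  rw [Submodule.mem_map_equiv]
  change (z : I n) ∈ coboundaries d S n ↔ (z : I n) ∈ coboundaries d S' n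
  rw [h2]

variable [IsNoetherianRing R] {M : Type u} [AddCommGroup M] [Module R M] {ι : Type*}
  [DecidableEq ι] (x : ι → R) (A : Finset ι) (J : Ideal R)

/-- If `J` is generated up to radical by the elements `x_a`, `a ∈ A`, then `H^{#A}_J(M)` is the
direct limit of the modules `M/(x_a^j : a ∈ A)M`. -/
theorem exists_isTelescope_localCohomology {n : ℕ} (hn : A.card = n)
    (hrad : (Ideal.span (x '' A)).radical = J.radical) :
    ∃ φ : ℕ → M →ₗ[R] (localCohomology J n).obj (ModuleCat.of R M),
      IsTelescope (∏ a ∈ A, x a)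
        (fun j => Ideal.span ((fun a => x a ^ j) '' A) • (⊤ : Submodule R M)) φ := by
  subst hn
  let E := InjectiveResolution.of (ModuleCat.of R M)
  obtain ⟨η, hinj, hη, hd⟩ := injectiveResolution_exact E
  obtain ⟨⟨φ, hφ⟩, -⟩ := exists_isTelescope_cohomology (M := M) hη hd hinj
    (W := ∅) Set.finite_empty (by simp) x A _ rfl (x '' A) (Set.empty_union _).symm
  obtain ⟨e⟩ := nonempty_cohomology_equiv_localCohomology J E A.card
  rw [← Ideal.span_eq J] at hrad
  obtain ⟨e'⟩ := nonempty_cohomology_equiv_of_radical_eq (I := fun n => E.cocomplex.X n)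
    (fun n => (E.cocomplex.d n (n + 1)).hom) hrad A.card
  exact ⟨_, hφ.comp_linearEquiv (e'.trans e)⟩

open Pointwise in
/-- Let `J` be generated up to radical by the elements of `W`, which act nilpotently on `M`, by
`x_b`, `b ∈ A`, and by `x_a`. Let `L` be the limit of the modules `M/(x_b^j : b ∈ A)M`. Every
element that annihilates `H^{#A}_J(M)` also annihilates the `x_a`-power torsion of `L`. -/
theorem exists_isTelescope_of_mem_annihilator {a : ι} {W : Set R} (hW : W.Finite)
    (hnil : ∀ w ∈ W, ∀ m : M, ∃ e : ℕ, w ^ e • m = 0)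
    (hrad : (Ideal.span (insert (x a) (W ∪ x '' A))).radical = J.radical) {z : R}
    (hz : z ∈ Module.annihilator R ((localCohomology J A.card).obj (ModuleCat.of R M))) :
    ∃ (L : Type u) (_ : AddCommGroup L) (_ : Module R L) (T : Type u) (_ : AddCommGroup T)
      (_ : Module R T) (φ : ℕ → M →ₗ[R] L) (ψ : ℕ → L →ₗ[R] T),
      IsTelescope (∏ b ∈ A, x b)
        (fun j => Ideal.span ((fun b => x b ^ j) '' A) • (⊤ : Submodule R M)) φ ∧
      IsTelescope (x a) (fun j => x a ^ j • (⊤ : Submodule R L)) ψ ∧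
      ∀ (p : ℕ) (t : L), x a ^ p • t = 0 → z • t = 0 := by
  let E := InjectiveResolution.of (ModuleCat.of R M)
  obtain ⟨η, hinj, hη, hd⟩ := injectiveResolution_exact E
  set d : ∀ n, E.cocomplex.X n →ₗ[R] E.cocomplex.X (n + 1) :=
    fun n => (E.cocomplex.d n (n + 1)).hom
  have hdd : ∀ n a, d (n + 1) (d n a) = 0 := fun n a => by
    change a ∈ LinearMap.ker (d (n + 1) ∘ₗ d n)
    rw [LinearMap.range_le_ker_iff.1 (hd n).le]
    trivial
  obtain ⟨⟨φ, hφ⟩, hvan⟩ := exists_isTelescope_cohomology (M := M) (d := d) hη hd hinj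
    hW hnil x A _ rfl _ rfl
  have hdiv : ∀ (n : ℕ) (b : E.cocomplex.X n), b ∈ powTorsion (W ∪ x '' A) (E.cocomplex.X n) →
      ∀ j : ℕ, ∃ c ∈ powTorsion (W ∪ x '' A) (E.cocomplex.X n),
        ∃ l : ℕ, x a ^ l • (x a ^ j • c - b) = 0 :=
    fun n b hb => exists_pow_smul_sub_eq_zero hb (x a)
  obtain ⟨ψ, hψ⟩ := exists_isTelescope_insert (I := fun n => E.cocomplex.X n) hdd hdiv
    (hvan A.card le_rfl)
  refine ⟨_, _, _, _, _, _, φ, ψ, hφ, hψ, fun p t ht => ?_⟩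
  obtain ⟨w, rfl⟩ := Submodule.Quotient.mk_surjective _ t
  rw [← Submodule.Quotient.mk_smul, cohomology_mk_eq_zero (I := fun n => E.cocomplex.X n)] at ht ⊢
  obtain ⟨w', hw', hww'⟩ := exists_cocycle_insert (I := fun n => E.cocomplex.X n) hdd hdiv w.2 ht
  obtain ⟨e⟩ := nonempty_cohomology_equiv_localCohomology J E A.card
  rw [← Ideal.span_eq J] at hrad
  obtain ⟨e'⟩ := nonempty_cohomology_equiv_of_radical_eq (I := fun n => E.cocomplex.X n) d hrad
    A.card
  have h3 : z • (Submodule.Quotient.mk ⟨w', hw'⟩ : Cohomology (I := fun n => E.cocomplex.X n) d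
      (insert (x a) (W ∪ x '' A)) A.card) = 0 := by
    apply (e'.trans e).injective
    rw [map_smul, map_zero]
    exact Module.mem_annihilator.1 hz _
  rw [← Submodule.Quotient.mk_smul, cohomology_mk_eq_zero (I := fun n => E.cocomplex.X n)] at h3
  have h4 := add_mem (Submodule.smul_mem _ z hww') (coboundaries_insert_le _ _ h3)
  rw [smul_sub] at h4
  change z • (w : E.cocomplex.X A.card) - z • w' + z • w' ∈ _ at h4
  rwa [sub_add_cancel] at h4

end LocalCohomologyTelescope

/-! ### Systems of parameters -/

section Parameters

variable {R : Type u} [CommRing R] [IsLocalRing R] {d : ℕ} {x : Fin d → R}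

/-- A system of parameters of `R` generates the maximal ideal up to radical. -/
theorem IsSystemOfParameters.radical_eq (hx : IsSystemOfParameters R x) :
    (Ideal.span (Set.range x)).radical = maximalIdeal R := by
  refine le_antisymm ?_ fun r hr => ?_
  · rw [(Ideal.IsMaximal.isPrime (maximalIdeal.isMaximal R)).radical_le_iff, Ideal.span_le]
    rintro _ ⟨i, rfl⟩
    exact hx.mem_maximalIdeal i
  · have := ((isFiniteLength_iff_isNoetherian_isArtinian.1 hx.finite_length).2)
    -- in `R/(x)` the powers of `r` satisfy `r ^ (n + 1) * y = r ^ n`, where `1 - r * y` is a unit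
    obtain ⟨n, y, hy⟩ := IsArtinian.exists_pow_succ_smul_dvd r
      (Submodule.Quotient.mk 1 : R ⧸ (Ideal.span (Set.range x) • (⊤ : Submodule R R)))
    obtain ⟨y, rfl⟩ := Submodule.Quotient.mk_surjective _ y
    rw [← Submodule.Quotient.mk_smul, ← Submodule.Quotient.mk_smul, eq_comm,
      Submodule.Quotient.eq, smul_eq_mul, smul_eq_mul, smul_eq_mul, Ideal.mul_top, mul_one] at hy
    have hu : IsUnit (1 - r * y) := by
      have := (IsLocalRing.mem_maximalIdeal _).1 (Ideal.mul_mem_right y _ hr)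
      exact (isUnit_or_isUnit_one_sub_self (r * y)).resolve_left this
    refine ⟨n, (Ideal.unit_mul_mem_iff_mem _ hu).1 ?_⟩
    convert! hy using 1
    rw [Nat.succ_eq_add_one, pow_succ]
    ring

end Parameters

section Dimension

variable {R : Type u} [CommRing R] [IsLocalRing R] [IsNoetherianRing R]

/-- Modulo `c` elements of the maximal ideal the dimension drops by at most `c`. -/
theorem le_dim_quotient_add_card {n : ℕ} (hn : Module.supportDim R R = n) (S : Finset R)
    (hS : (S : Set R) ⊆ maximalIdeal R) :
    n ≤ dim R (R ⧸ (Ideal.span (S : Set R) • (⊤ : Submodule R R))) + S.card := by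
  have h1 := ringKrullDim_le_ringKrullDim_quotient_add_card S
    (by rwa [IsLocalRing.ringJacobson_eq_maximalIdeal])
  have h2 := ringKrullDim_quotient_le (Ideal.span (S : Set R))
  rw [Module.supportDim_self_eq_ringKrullDim] at hn
  rw [dim, smul_eq_mul, Ideal.mul_top, Module.supportDim_quotient_eq_ringKrullDim]
  rw [hn] at h1 h2
  induction h : ringKrullDim (R ⧸ Ideal.span (S : Set R)) with
  | bot =>
    rw [h, WithBot.bot_add] at h1
    exact absurd h1 (by simp)
  | coe D =>
    rw [h] at h1 h2
    have h1 : (n : ℕ∞) ≤ D + S.card := by exact_mod_cast h1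
    have h2 : D ≤ n := by exact_mod_cast h2
    lift D to ℕ using ne_top_of_le_ne_top (ENat.natCast_ne_top n) h2
    simpa using (by exact_mod_cast h1 : n ≤ D + S.card)

end Dimension

/-! ### Lifting the socle -/

section Socle

theorem mem_socle {R : Type u} [CommRing R] [IsLocalRing R] {M : Type*} [AddCommGroup M]
    [Module R M] {y : M} : y ∈ socle R M ↔ ∀ r ∈ maximalIdeal R, r • y = 0 := by
  rw [socle, Submodule.mem_torsionBySet_iff]
  exact ⟨fun h r hr => h ⟨r, hr⟩, fun h r => h r r.2⟩

theorem comap_mkQ_smul_top {R : Type*} [CommRing R] (K I : Ideal R) :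
    (I • (⊤ : Submodule R (R ⧸ K))).comap K.mkQ = I ⊔ K := by
  have : I • (⊤ : Submodule R (R ⧸ K)) = Submodule.map K.mkQ I := by
    rw [← LinearMap.range_eq_top.2 K.mkQ_surjective, LinearMap.range_eq_map,
      ← Submodule.map_smul'', smul_eq_mul, Ideal.mul_top]
  rw [this, Submodule.comap_map_mkQ, sup_comm]

variable {R : Type u} [CommRing R] {d : ℕ} (x : Fin d → R) (s : ℕ)

/-- The indices that are smaller than `i`. -/
abbrev initialIndices (d i : ℕ) : Finset (Fin d) := Finset.univ.filter fun k => (k : ℕ) < i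

/-- The ideal generated by the `j`-th powers of the first `i` elements and by the `s`-th powers of
the others. -/
def mixedPowIdeal (i j : ℕ) : Ideal R :=
  Ideal.span ((fun k => x k ^ j) '' (initialIndices d i : Set (Fin d))) ⊔
    Ideal.span ((fun k => x k ^ s) '' {k | i ≤ k})

theorem mixedPowIdeal_zero (j : ℕ) : mixedPowIdeal x s 0 j = powIdeal x s := by
  simp [mixedPowIdeal, powIdeal]

theorem mixedPowIdeal_self (j : ℕ) : mixedPowIdeal x s d j = powIdeal x j := by
  have h : {k : Fin d | d ≤ (k : ℕ)} = ∅ := by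
    ext k
    simp
  simp [mixedPowIdeal, powIdeal, h]

variable {x s}

theorem initialIndices_succ {i : ℕ} (hi : i < d) :
    initialIndices d (i + 1) = insert ⟨i, hi⟩ (initialIndices d i) := by
  ext k
  simp only [Finset.mem_filter, Finset.mem_univ, true_and, Finset.mem_insert, Fin.ext_iff]
  omega

theorem initialIndices_self : initialIndices d d = Finset.univ := by
  ext k
  simp

theorem card_initialIndices {i : ℕ} (hi : i < d) : (initialIndices d i).card = i := by
  have : initialIndices d i = Finset.Iio ⟨i, hi⟩ := by
    ext k
    simp [Fin.lt_def]
  rw [this, Fin.card_Iio]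

variable [IsLocalRing R]

theorem socle_le_torsionBy {T : Type*} [AddCommGroup T] [Module R T] {a : R}
    (ha : a ∈ maximalIdeal R) : socle R T ≤ Submodule.torsionBy R T a := fun _ hy =>
  (Submodule.mem_torsionBy_iff _ _).2 (mem_socle.1 hy a ha)

variable [IsNoetherianRing R]

open Pointwise in
/-- Let `L` be the limit over `j` of the `R/(x_1^j, …, x_i^j, x_{i+2}^s, …, x_d^s)`. The element
`x_{i+1}` annihilates the `x_{i+1}`-power torsion of `L`, because it annihilates the local
cohomology module of degree `i` of `R/(x_{i+2}^s, …, x_d^s)`. -/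
theorem IsPsStandard.exists_isTelescope_pair (hx : IsPsStandard R s x) (hs : 0 < s) {i : ℕ} (hi : i < d) :
    ∃ (L : Type u) (_ : AddCommGroup L) (_ : Module R L) (T : Type u) (_ : AddCommGroup T)
      (_ : Module R T) (φ : ℕ → R →ₗ[R] L) (ψ : ℕ → L →ₗ[R] T),
      IsTelescope (∏ k ∈ initialIndices d i, x k) (mixedPowIdeal x s i)
        (fun j => (x ⟨i, hi⟩ ^ s • (⊤ : Submodule R L)).mkQ ∘ₗ φ j) ∧
      IsTelescope (∏ k ∈ initialIndices d (i + 1), x k) (mixedPowIdeal x s (i + 1))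
        (fun j => ψ j ∘ₗ φ j) ∧
      IsTelescope (x ⟨i, hi⟩) (fun j => x ⟨i, hi⟩ ^ j • (⊤ : Submodule R L)) ψ ∧
      ∀ (p : ℕ) (t : L), x ⟨i, hi⟩ ^ p • t = 0 → x ⟨i, hi⟩ • t = 0 := by
  set a : Fin d := ⟨i, hi⟩ with ha
  have hcard := card_initialIndices hi
  have hnot : a ∉ initialIndices d i := by simp [ha]
  set K : Ideal R := Ideal.span ((fun j => x j ^ s) '' Set.Ioi a) • (⊤ : Submodule R R) with hK
  have hK' : K = Ideal.span ((fun j => x j ^ s) '' Set.Ioi a) := by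
    rw [hK, smul_eq_mul, Ideal.mul_top]
  have hW : (x '' Set.Ioi a).Finite := Set.toFinite _
  have hnil : ∀ w ∈ x '' Set.Ioi a, ∀ m : R ⧸ K, ∃ e : ℕ, w ^ e • m = 0 := by
    rintro _ ⟨k, hk, rfl⟩ m
    obtain ⟨r, rfl⟩ := Submodule.Quotient.mk_surjective _ m
    refine ⟨s, ?_⟩
    rw [← Submodule.Quotient.mk_smul, Submodule.Quotient.mk_eq_zero, hK', smul_eq_mul]
    exact Ideal.mul_mem_right _ _ (Ideal.subset_span ⟨k, hk, rfl⟩)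
  have hrad : (Ideal.span (insert (x a)
      (x '' Set.Ioi a ∪ x '' (initialIndices d i : Set (Fin d))))).radical = (maximalIdeal R).radical := by
    rw [(Ideal.IsMaximal.isPrime (maximalIdeal.isMaximal R)).radical,
      ← hx.toIsSystemOfParameters.radical_eq, ← Set.image_union, ← Set.image_insert_eq,
      ← Set.image_univ]
    congr 3
    ext k
    simp only [Set.mem_insert_iff, Set.mem_union, Set.mem_Ioi, Finset.mem_coe, Finset.mem_filter,
      Finset.mem_univ, true_and, Set.mem_univ, iff_true, ha, Fin.ext_iff, Fin.lt_def]
    omega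
  -- the product defining `𝔞 R (R ⧸ K)` thus contains the factor of index `i`
  have hdim : i < dim R (R ⧸ K) := by
    classical
    have h := le_dim_quotient_add_card hx.dim_eq ((Finset.Ioi a).image fun j => x j ^ s) ?_
    · rw [Finset.coe_image, Finset.coe_Ioi] at h
      have h2 : ((Finset.Ioi a).image fun j => x j ^ s).card ≤ d - 1 - i :=
        Finset.card_image_le.trans (by rw [Fin.card_Ioi])
      change i < dim R (R ⧸ (Ideal.span ((fun j => x j ^ s) '' Set.Ioi a) • (⊤ : Submodule R R)))
      omega
    · rw [Finset.coe_image]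
      rintro _ ⟨j, -, rfl⟩
      exact Ideal.pow_mem_of_mem _ (hx.mem_maximalIdeal j) s hs
  have hz : x a ∈ Module.annihilator R
      ((localCohomology (maximalIdeal R) (initialIndices d i).card).obj
        (ModuleCat.of R (R ⧸ K))) := by
    rw [hcard]
    exact (Ideal.prod_le_inf.trans (Finset.inf_le (Finset.mem_range.2 hdim))) (hx.mem_𝔞 a)
  obtain ⟨L, iL, iL', T, iT, iT', φ, ψ, hφ, hψ, htor⟩ :=
    exists_isTelescope_of_mem_annihilator x (initialIndices d i) (maximalIdeal R) hW hnil hrad hz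
  refine ⟨L, iL, iL', T, iT, iT', fun j => φ j ∘ₗ K.mkQ, ψ, ?_, ?_, hψ, htor⟩
  · refine ((hφ.mkQ_comp (x a ^ s)).comp_surjective K.mkQ_surjective).congr rfl fun j => ?_
    rw [← Submodule.ideal_span_singleton_smul, ← Submodule.sup_smul, comap_mkQ_smul_top, hK',
      mixedPowIdeal, sup_assoc, ← Ideal.span_union, ← Set.image_singleton (f := fun k => x k ^ s),
      ← Set.image_union]
    congr 3
    ext k
    simp only [Set.mem_union, Set.mem_singleton_iff, Set.mem_Ioi, Set.mem_ofPred_eq, ha,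
      Fin.ext_iff, Fin.lt_def]
    omega
  · rw [initialIndices_succ hi]
    refine ((hφ.comp_insert x hnot hψ).comp_surjective K.mkQ_surjective).congr rfl fun j => ?_
    rw [comap_mkQ_smul_top, hK', mixedPowIdeal, initialIndices_succ hi]
    rfl

open Pointwise in
/-- The socle of any limit of the `R/(x_1^j, …, x_i^j, x_{i+1}^s, …, x_d^s)` lifts linearly to
the socle of `R/(x_1^s, …, x_d^s)`. -/
theorem IsPsStandard.exists_socle_section (hx : IsPsStandard R s x) (hs : 2 ≤ s) {i : ℕ}
    (hi : i ≤ d) {N : Type u} [AddCommGroup N] [Module R N] {φ : ℕ → R →ₗ[R] N}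
    (hφ : IsTelescope (∏ k ∈ initialIndices d i, x k) (mixedPowIdeal x s i) φ) :
    ∃ σ : socle R N →ₗ[R] socle R (R ⧸ powIdeal x s),
      ∀ (z : socle R N) (r : R), Submodule.Quotient.mk r = (σ z : R ⧸ powIdeal x s) →
        φ s r = z := by
  induction i generalizing N with
  | zero =>
    have h0 : initialIndices d 0 = ∅ := by simp
    rw [h0, Finset.prod_empty] at hφ
    have hker : ∀ r, φ s r = 0 ↔ r ∈ powIdeal x s := by
      intro r
      rw [hφ.eq_zero_iff]
      simp [mixedPowIdeal_zero]
    have hsurj : Function.Surjective (φ s) := by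
      intro t
      obtain ⟨j, hj, r, rfl⟩ := hφ.exists_ge s t
      refine ⟨r, ?_⟩
      rw [← hφ.map_pow_sub_smul hj]
      simp
    let e : (R ⧸ powIdeal x s) ≃ₗ[R] N :=
      (Submodule.quotEquivOfEq _ _ (by ext r; exact (hker r).symm)).trans
        ((φ s).quotKerEquivOfSurjective hsurj)
    refine ⟨socleMap e.symm.toLinearMap, fun z r hr => ?_⟩
    have : e (Submodule.Quotient.mk r) = z := by
      rw [hr]
      exact e.apply_symm_apply z
    exact this
  | succ i ih =>
    obtain ⟨L, _, _, T, _, _, φ', ψ, h1, h2, hψ, htor⟩ := hx.exists_isTelescope_pair (by omega) hi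
    obtain ⟨σ, hσ⟩ := ih (by omega) h1
    obtain ⟨τ, hτ⟩ := hψ.exists_section htor hs
    obtain ⟨e, he⟩ := h2.exists_linearEquiv hφ
    have hle := socle_le_torsionBy (T := T) (hx.mem_maximalIdeal ⟨i, hi⟩)
    -- `τ` is restricted to the socle, which it maps into the socle of `L / x_{i+1}^s L`
    let ρ : socle R N →ₗ[R] Submodule.torsionBy R T (x ⟨i, hi⟩) :=
      Submodule.inclusion hle ∘ₗ socleMap e.symm.toLinearMap
    let τ' : socle R N →ₗ[R] socle R (L ⧸ (x ⟨i, hi⟩ ^ s • (⊤ : Submodule R L))) :=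
      (τ ∘ₗ ρ).codRestrict _ fun z => mem_socle.2 fun r hr => by
        rw [← map_smul, show r • z = 0 from Subtype.ext (mem_socle.1 z.2 r hr), map_zero]
    refine ⟨σ ∘ₗ τ', fun z r hr => ?_⟩
    have h3 := hτ (ρ z) (φ' s r) (hσ (τ' z) r hr)
    rw [← he]
    change e (ψ s (φ' s r)) = z
    rw [h3]
    exact e.apply_symm_apply z

end Socle

section Limit

variable {R : Type u} [CommRing R] {d : ℕ} (x : Fin d → R)

/-- The direct limit of the `R/(x_1^j, …, x_d^j)`, seen as a limit of quotients of `R`. -/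
theorem isTelescope_limit :
    IsTelescope (∏ k, x k) (powIdeal x) (fun j => toLimit x j ∘ₗ (powIdeal x j).mkQ) where
  map_smul j r := by
    have := Module.DirectLimit.of_f (R := R) (ι := ℕ) (G := fun j => R ⧸ powIdeal x j)
      (f := transition x) (hij := Nat.le_succ j) (x := Submodule.Quotient.mk r)
    refine Eq.trans ?_ this
    change toLimit x (j + 1) _ = toLimit x (j + 1) _
    congr 1
    change _ = Submodule.Quotient.mk ((∏ k, x k) ^ (j + 1 - j) * r)
    rw [Nat.add_sub_cancel_left, pow_one]
    rfl
  surjective t := by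
    obtain ⟨j, y, rfl⟩ := Module.DirectLimit.exists_of t
    obtain ⟨r, rfl⟩ := Submodule.Quotient.mk_surjective _ y
    exact ⟨j, r, rfl⟩
  eq_zero_iff j r := by
    have htr : ∀ p, transition x j (j + p) (Nat.le_add_right _ _) (Submodule.Quotient.mk r) = 0 ↔
        (∏ k, x k) ^ p • r ∈ powIdeal x (j + p) := by
      intro p
      change Submodule.Quotient.mk ((∏ k, x k) ^ (j + p - j) * r) = 0 ↔ _
      rw [Submodule.Quotient.mk_eq_zero, Nat.add_sub_cancel_left, smul_eq_mul]
    constructor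
    · intro h
      obtain ⟨k, hjk, hk⟩ := Module.DirectLimit.of.zero_exact h
      obtain ⟨p, rfl⟩ := Nat.exists_eq_add_of_le hjk
      exact ⟨p, (htr p).1 hk⟩
    · rintro ⟨p, hp⟩
      have := Module.DirectLimit.of_f (R := R) (ι := ℕ) (G := fun j => R ⧸ powIdeal x j)
        (f := transition x) (hij := Nat.le_add_right j p) (x := Submodule.Quotient.mk r)
      rw [(htr p).2 hp, map_zero] at this
      exact this.symm

end Limit

end PsStandard

theorem mainTheorem2 {R : Type u} [CommRing R] [IsNoetherianRing R] [IsLocalRing R]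
    {d : ℕ} (x : Fin d → R) {s : ℕ} (hs : 2 ≤ s) (hx : PsStandard.IsPsStandard R s x) :
    Nonempty (PsStandard.limit x ≃ₗ[R] PsStandard.H R R d) ∧
    ∀ e : PsStandard.limit x ≃ₗ[R] PsStandard.H R R d,
      (∃ σ : PsStandard.socle R (PsStandard.H R R d) →ₗ[R]
          PsStandard.socle R (R ⧸ PsStandard.powIdeal x s),
        PsStandard.socleMap (e.toLinearMap ∘ₗ PsStandard.toLimit x s) ∘ₗ σ = LinearMap.id) ∧
      ∀ i : ℕ, s ≤ i →
        Function.Surjective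
          (PsStandard.socleMap (e.toLinearMap ∘ₗ PsStandard.toLimit x i)) := by
  have hlim := PsStandard.isTelescope_limit x
  refine ⟨?_, fun e => ?_⟩
  · obtain ⟨φ, hφ⟩ := PsStandard.exists_isTelescope_localCohomology (M := R) x Finset.univ
      (IsLocalRing.maximalIdeal R) (Finset.card_fin d)
      (by rw [Finset.coe_univ, Set.image_univ, hx.toIsSystemOfParameters.radical_eq,
        (Ideal.IsMaximal.isPrime (IsLocalRing.maximalIdeal.isMaximal R)).radical])
    obtain ⟨e, -⟩ := hlim.exists_linearEquiv (hφ.congr rfl fun j => by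
      rw [Finset.coe_univ, Set.image_univ, smul_eq_mul, Ideal.mul_top]
      rfl)
    exact ⟨e⟩
  · obtain ⟨σ, hσ⟩ := hx.exists_socle_section hs le_rfl
      ((hlim.comp_linearEquiv e).congr (by rw [PsStandard.initialIndices_self])
        fun j => (PsStandard.mixedPowIdeal_self x s j).symm)
    have hid : PsStandard.socleMap (e.toLinearMap ∘ₗ PsStandard.toLimit x s) ∘ₗ σ =
        LinearMap.id := by
      refine LinearMap.ext fun z => Subtype.ext ?_
      obtain ⟨r, hr⟩ := Submodule.Quotient.mk_surjective _
        (σ z : R ⧸ PsStandard.powIdeal x s)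
      have := hσ z r hr
      change e (PsStandard.toLimit x s (σ z : R ⧸ PsStandard.powIdeal x s)) = z
      rw [← hr]
      exact this
    refine ⟨⟨σ, hid⟩, fun i hi z => ⟨PsStandard.socleMap (PsStandard.transition x s i hi) (σ z), ?_⟩⟩
    refine Eq.trans (Subtype.ext ?_) (LinearMap.congr_fun hid z)
    exact congrArg e (Module.DirectLimit.of_f (R := R) (ι := ℕ)
      (G := fun j => R ⧸ PsStandard.powIdeal x j) (f := PsStandard.transition x) (hij := hi)
      (x := (σ z : R ⧸ PsStandard.powIdeal x s)))
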